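/- Let $N\ge 2$ be an integer and let $B,L\subset\mathbb Z$ be finite sets with $\#B=\#L\ge 2$ such that $(N,B,L)$ is a Hadamard triple, i.e. the matrix $\big(\tfrac{1}{\sqrt{\#B}}e^{2\pi i b\ell/N}\big)_{b\in B,\ell\in L}$ is unitary, and assume $\#B<N$. Let $\mu_{N,B}$ be the self-similar measure, i.e. the unique Borel probability measure $\mu$ on $\mathbb R$ with $\mu=\frac1{\#B}\sum_{b\in B}\mu\circ\tau_b^{-1}$, where $\tau_b(x)=(x+b)/N$. A set $\Lambda\subset\mathbb R$ is called a spectrum of $\mu$ if the exponentials $e^{2\pi i\lambda x}$, $\lambda\in\Lambda$, form an orthonormal basis of $L^2(\mu)$, and $t\in\mathbb R$ is called a spectral eigenvalue of $\mu$ if there is a set $\Lambda\subset\mathbb R$ such that both $\Lambda$ and $t\Lambda$ are spectra of $\mu$. Put $$\mathcal E_N=\Big\{\frac vu:\ u,v\in\mathbb Z_{>0},\ \gcd(u,v)=1,\ \gcd(uv,N)=1\Big\}.$$ Then every $t\in\mathcal E_N$ is a spectral eigenvalue of $\mu_{N,B}$, and the set $\mathcal E_N\subset[0,\infty)$ is dense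 in $[0,\infty)$. Moreover, for any finitely many $t_1,\dots,t_k\in\mathcal E_N$, the set $$\{\Lambda\subset\mathbb R:\ 0\in\Lambda\ \text{and}\ \Lambda,t_1\Lambda,\dots,t_k\Lambda\ \text{are spectra of }\mu_{N,B}\}$$ is infinite. -/

import Mathlib

open MeasureTheory Matrix
open scoped Pointwise ENNReal

/-- The `B × L` matrix with entries `e^{2πi bℓ/N} / √#B`. -/
noncomputable def hadamardMatrix (N : ℕ) (B L : Finset ℤ) : Matrix B L ℂ :=
  Matrix.of fun b l =>
    (1 / (Real.sqrt B.card : ℂ)) *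
      Complex.exp (2 * Real.pi * Complex.I * (((b : ℤ) : ℂ) * ((l : ℤ) : ℂ) / (N : ℂ)))

/-- `(N, B, L)` is a Hadamard triple in `ℝ`: `N ≥ 2`, `B, L ⊆ ℤ` are finite with `#B = #L ≥ 2`, and
the matrix `M` with entries `e^{2πi bℓ/N} / √#B` is unitary, i.e. `M* M = I`. -/
structure IsHadamardTriple (N : ℕ) (B L : Finset ℤ) : Prop where
  two_le : 2 ≤ N
  card_eq : B.card = L.card
  two_le_card : 2 ≤ B.card
  unitary : (hadamardMatrix N B L)ᴴ * hadamardMatrix N B L = 1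

/-- The measure `μ` satisfies `μ = (1 / #B) ∑_{b ∈ B} μ ∘ τ_b⁻¹`, where `τ_b x = (x + b) / N`. -/
def IsSelfSimilar (N : ℕ) (B : Finset ℤ) (μ : Measure ℝ) : Prop :=
  μ = (B.card : ℝ≥0∞)⁻¹ • ∑ b ∈ B, μ.map (fun x : ℝ => (x + (b : ℝ)) / (N : ℝ))

/-- The self-similar measure `μ_{N,B}`: the Borel probability measure on `ℝ` that is self-similar
for the maps `τ_b x = (x + b) / N`, `b ∈ B`. It exists and is unique as soon as `N ≥ 2` and
`B` is nonempty, see `existsUnique_isSelfSimilar` and `isSelfSimilar_selfSimilarMeasure`. -/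
noncomputable def selfSimilarMeasure (N : ℕ) (B : Finset ℤ) : ProbabilityMeasure ℝ :=
  Classical.epsilon fun μ : ProbabilityMeasure ℝ => IsSelfSimilar N B (μ : Measure ℝ)

section SelfSimilar

lemma charFun_of_isSelfSimilar {N : ℕ} {B : Finset ℤ} {μ : Measure ℝ} [IsProbabilityMeasure μ]
    (h : IsSelfSimilar N B μ) (t : ℝ) :
    charFun μ t = ((B.card : ℂ)⁻¹ * ∑ b ∈ B, Complex.exp (t * ((b : ℝ) / (N : ℝ) : ℝ) * Complex.I)) *
      charFun μ (t / N) := by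
  have hm : ∀ b : ℤ, Measurable (fun x : ℝ => (x + (b : ℝ)) / (N : ℝ)) := fun b => by fun_prop
  conv_lhs => rw [h]
  rw [charFun_apply_real, integral_smul_measure, integral_finsetSum_measure, mul_assoc,
    Finset.sum_mul]
  · have hc : ((B.card : ℝ≥0∞)⁻¹).toReal = (B.card : ℝ)⁻¹ := by simp
    rw [hc, Complex.real_smul]
    push_cast
    congr 1
    refine Finset.sum_congr rfl fun b _ => ?_
    rw [integral_map (hm b).aemeasurable (by fun_prop), charFun_apply_real,
      ← integral_const_mul]
    refine integral_congr_ae (Filter.Eventually.of_forall fun x => ?_)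
    simp only
    rw [← Complex.exp_add]
    congr 1
    push_cast
    ring
  · intro b _
    have : IsProbabilityMeasure (μ.map (fun x : ℝ => (x + (b : ℝ)) / (N : ℝ))) :=
      Measure.isProbabilityMeasure_map (hm b).aemeasurable
    refine (integrable_const (1 : ℝ)).mono' (by fun_prop) (Filter.Eventually.of_forall fun x => ?_)
    rw [← Complex.ofReal_mul, Complex.norm_exp_ofReal_mul_I]

lemma isSelfSimilar_unique {N : ℕ} {B : Finset ℤ} (hN : 2 ≤ N) {μ ν : Measure ℝ}
    [IsProbabilityMeasure μ] [IsProbabilityMeasure ν]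
    (hμ : IsSelfSimilar N B μ) (hν : IsSelfSimilar N B ν) : μ = ν := by
  refine Measure.ext_of_charFun (funext fun t => ?_)
  have step : ∀ s : ℝ, ‖charFun μ s - charFun ν s‖ ≤ ‖charFun μ (s / N) - charFun ν (s / N)‖ := by
    intro s
    rw [charFun_of_isSelfSimilar hμ s, charFun_of_isSelfSimilar hν s, ← mul_sub, norm_mul]
    refine mul_le_of_le_one_left (norm_nonneg _) ?_
    rw [norm_mul, norm_inv, Complex.norm_natCast]
    have h1 : ‖∑ b ∈ B, Complex.exp (s * ((b : ℝ) / (N : ℝ) : ℝ) * Complex.I)‖ ≤ B.card := by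
      refine (norm_sum_le _ _).trans ?_
      simp only [← Complex.ofReal_mul, Complex.norm_exp_ofReal_mul_I]
      simp
    exact inv_mul_le_one_of_le₀ h1 (Nat.cast_nonneg _)
  have iter : ∀ n : ℕ, ‖charFun μ t - charFun ν t‖ ≤
      ‖charFun μ (t * ((N : ℝ)⁻¹) ^ n) - charFun ν (t * ((N : ℝ)⁻¹) ^ n)‖ := by
    intro n
    induction n with
    | zero => simp
    | succ n ih =>
      refine ih.trans ((step _).trans (le_of_eq ?_))
      rw [pow_succ, ← mul_assoc, ← div_eq_mul_inv]
  have hN' : ((N : ℝ)⁻¹) < 1 := inv_lt_one_of_one_lt₀ (by exact_mod_cast hN)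
  have hz : Filter.Tendsto (fun n : ℕ => t * ((N : ℝ)⁻¹) ^ n) Filter.atTop (nhds 0) := by
    simpa using (tendsto_pow_atTop_nhds_zero_of_lt_one (by positivity) hN').const_mul t
  have hcont : Continuous fun s : ℝ => ‖charFun μ s - charFun ν s‖ := by fun_prop
  have hlim := (hcont.tendsto 0).comp hz
  have h0 : ‖charFun μ t - charFun ν t‖ ≤ ‖charFun μ 0 - charFun ν 0‖ :=
    ge_of_tendsto' hlim iter
  have : ‖charFun μ t - charFun ν t‖ ≤ 0 := by simpa using h0
  exact sub_eq_zero.mp (norm_le_zero_iff.mp this)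

lemma exists_isSelfSimilar {N : ℕ} {B : Finset ℤ} (hN : 2 ≤ N) (hB : B.Nonempty) :
    ∃ μ : Measure ℝ, IsProbabilityMeasure μ ∧ IsSelfSimilar N B μ := by
  have hc0 : (B.card : ℝ≥0∞) ≠ 0 := by simpa using hB.ne_empty
  have hcT : (B.card : ℝ≥0∞) ≠ ∞ := ENNReal.natCast_ne_top _
  -- the uniform measure on `B`
  let u : Measure B := (B.card : ℝ≥0∞)⁻¹ • ∑ b : B, Measure.dirac b
  have hu : IsProbabilityMeasure u := ⟨by
    simp [u, ENNReal.inv_mul_cancel hc0 hcT]⟩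
  let P : Measure (ℕ → B) := Measure.infinitePi fun _ => u
  let c : B × (ℕ → B) → ℕ → B := fun p n => Nat.casesOn n p.1 p.2
  have hcm : Measurable c := by
    refine measurable_pi_lambda _ fun n => ?_
    cases n with
    | zero => exact measurable_fst
    | succ n => exact (measurable_pi_apply n).comp measurable_snd
  have hmap : (u.prod P).map c = P := by
    refine Measure.eq_infinitePi _ fun s t ht => ?_
    rw [Measure.map_apply hcm (MeasurableSet.pi s.countable_toSet fun i _ => ht i)]
    let t' : ℕ → Set B := fun i => if i ∈ s then t i else Set.univ
    have ht' : ∀ i, MeasurableSet (t' i) := fun i => by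
      by_cases hi : i ∈ s <;> simp [t', hi, ht i]
    obtain ⟨n, hn⟩ : ∃ n, s ⊆ Finset.range n := s.exists_nat_subset_range
    have hpre : c ⁻¹' (Set.pi s t) =
        t' 0 ×ˢ Set.pi (Finset.range n : Finset ℕ) (fun i => t' (i + 1)) := by
      ext p
      simp only [Set.mem_preimage, Set.mem_pi, Set.mem_prod, Finset.mem_coe]
      constructor
      · intro h
        refine ⟨?_, fun i _ => ?_⟩
        · by_cases h0 : 0 ∈ s
          · simpa [t', h0, c] using h 0 h0
          · simp [t', h0]
        · by_cases h0 : i + 1 ∈ s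
          · simpa [t', h0, c] using h (i + 1) h0
          · simp [t', h0]
      · rintro ⟨h0, h1⟩ i hi
        cases i with
        | zero => simpa [t', hi, c] using h0
        | succ i =>
          have := h1 i (by have := Finset.mem_range.mp (hn hi); simp; omega)
          simpa [t', hi, c] using this
    rw [hpre, Measure.prod_prod, Measure.infinitePi_pi _ (fun i _ => ht' _)]
    rw [mul_comm, ← Finset.prod_range_succ' (fun i => u (t' i)) n]
    have hs : s ⊆ Finset.range (n + 1) :=
      hn.trans (Finset.range_mono (Nat.le_succ n))
    rw [← Finset.prod_subset hs (f := fun i => u (t' i))]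
    · exact Finset.prod_congr rfl fun i hi => by simp [t', hi]
    · intro i _ hi
      simp [t', hi]
  let X : (ℕ → B) → ℝ := fun ω => ∑' i, ((ω i : ℤ) : ℝ) * ((N : ℝ)⁻¹) ^ (i + 1)
  have hN' : ((N : ℝ)⁻¹) < 1 := inv_lt_one_of_one_lt₀ (by exact_mod_cast hN)
  have hN0 : (0 : ℝ) ≤ (N : ℝ)⁻¹ := by positivity
  have hsum : ∀ ω : ℕ → B, Summable fun i => ((ω i : ℤ) : ℝ) * ((N : ℝ)⁻¹) ^ (i + 1) := by
    intro ω
    have hg : Summable fun i : ℕ => (∑ b ∈ B, |(b : ℝ)|) * ((N : ℝ)⁻¹) ^ (i + 1) :=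
      ((summable_nat_add_iff 1).mpr (summable_geometric_of_lt_one hN0 hN')).mul_left _
    refine Summable.of_norm_bounded hg fun i => ?_
    rw [norm_mul, norm_pow, Real.norm_of_nonneg hN0]
    refine mul_le_mul_of_nonneg_right ?_ (by positivity)
    exact Finset.single_le_sum (f := fun b : ℤ => |(b : ℝ)|) (fun _ _ => abs_nonneg _) (ω i).2
  have hXm : Measurable X := by
    refine measurable_of_tendsto_metrizable
      (f := fun (n : ℕ) ω => ∑ i ∈ Finset.range n, ((ω i : ℤ) : ℝ) * ((N : ℝ)⁻¹) ^ (i + 1)) ?_ ?_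
    · intro n
      refine Finset.measurable_sum _ fun i _ => Measurable.mul_const ?_ _
      exact (Measurable.of_discrete (f := fun b : B => ((b : ℤ) : ℝ))).comp (measurable_pi_apply i)
    · exact tendsto_pi_nhds.mpr fun ω => (hsum ω).hasSum.tendsto_sum_nat
  have hXc : ∀ p : B × (ℕ → B), X (c p) = (X p.2 + ((p.1 : ℤ) : ℝ)) / N := by
    intro p
    have h1 := (hsum (c p)).tsum_eq_zero_add
    simp only [X]
    rw [h1, add_div, ← tsum_div_const, add_comm]
    congr 1
    · refine tsum_congr fun i => ?_
      simp only [c]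
      rw [pow_succ _ (i + 1)]
      ring
    · simp [c, div_eq_mul_inv]
  refine ⟨P.map X, Measure.isProbabilityMeasure_map hXm.aemeasurable, ?_⟩
  unfold IsSelfSimilar
  ext S hS
  have hm : ∀ b : ℤ, Measurable (fun x : ℝ => (x + (b : ℝ)) / (N : ℝ)) := fun b => by fun_prop
  rw [Measure.map_apply hXm hS]
  conv_lhs => rw [← hmap]
  rw [Measure.map_apply hcm (hXm hS), Measure.prod_apply (hcm (hXm hS))]
  simp only [u, lintegral_smul_measure, lintegral_finsetSum_measure, lintegral_dirac,
    Measure.smul_apply, Measure.finsetSum_apply]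
  congr 1
  rw [← Finset.sum_coe_sort B]
  refine Finset.sum_congr rfl fun b _ => ?_
  rw [Measure.map_apply (hm b) hS, Measure.map_apply hXm (hm b hS)]
  congr 1
  ext ω
  simp [hXc]

/-- Existence and uniqueness of the self-similar probability measure. -/
theorem existsUnique_isSelfSimilar {N : ℕ} {B : Finset ℤ} (hN : 2 ≤ N) (hB : B.Nonempty) :
    ∃! μ : ProbabilityMeasure ℝ, IsSelfSimilar N B (μ : Measure ℝ) := by
  obtain ⟨μ, h, hμ⟩ := exists_isSelfSimilar hN hB
  exact ⟨⟨μ, h⟩, hμ, fun ν hν => Subtype.ext (@isSelfSimilar_unique N B hN ν μ ν.2 h hν hμ)⟩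

theorem isSelfSimilar_selfSimilarMeasure {N : ℕ} {B : Finset ℤ} (hN : 2 ≤ N) (hB : B.Nonempty) :
    IsSelfSimilar N B (selfSimilarMeasure N B : Measure ℝ) :=
  Classical.epsilon_spec (p := fun μ : ProbabilityMeasure ℝ => IsSelfSimilar N B (μ : Measure ℝ))
    (existsUnique_isSelfSimilar hN hB).exists

end SelfSimilar

lemma memLp_exponential (μ : Measure ℝ) [IsFiniteMeasure μ] (r : ℝ) :
    MemLp (fun x : ℝ => Complex.exp (2 * Real.pi * Complex.I * (r : ℂ) * (x : ℂ))) 2 μ := by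
  refine MemLp.of_bound (by fun_prop) 1 (Filter.Eventually.of_forall fun x => ?_)
  have : 2 * Real.pi * Complex.I * (r : ℂ) * (x : ℂ) =
      ((2 * Real.pi * r * x : ℝ) : ℂ) * Complex.I := by push_cast; ring
  rw [this, Complex.norm_exp_ofReal_mul_I]

/-- The exponential `e_r(x) = e^{2πi r x}` as an element of the Hilbert space `L²(μ)`. -/
noncomputable def exponential (μ : Measure ℝ) [IsFiniteMeasure μ] (r : ℝ) : Lp ℂ 2 μ :=
  (memLp_exponential μ r).toLp

/-- `Λ` is a spectrum of `μ`: the exponentials `e_r`, `r ∈ Λ`, form an orthonormal basis of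
`L²(μ)`, i.e. an orthonormal family with dense linear span. -/
def IsSpectrum (μ : Measure ℝ) [IsFiniteMeasure μ] (Λ : Set ℝ) : Prop :=
  Orthonormal ℂ (fun r : Λ => exponential μ (r : ℝ)) ∧
    (Submodule.span ℂ (Set.range fun r : Λ => exponential μ (r : ℝ))).topologicalClosure = ⊤

/-- `t` is a spectral eigenvalue of `μ`: both `Λ` and `tΛ` are spectra of `μ` for some `Λ ⊆ ℝ`. -/
def IsSpectralEigenvalue (μ : Measure ℝ) [IsFiniteMeasure μ] (t : ℝ) : Prop :=
  ∃ Λ : Set ℝ, IsSpectrum μ Λ ∧ IsSpectrum μ (t • Λ)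

/-- The set `ℰ_N` of the rationals `v / u` with `u, v` positive and coprime, `gcd(uv, N) = 1`. -/
def eigenvalueSet (N : ℕ) : Set ℝ :=
  {t | ∃ u v : ℕ, 0 < u ∧ 0 < v ∧ Nat.gcd u v = 1 ∧ Nat.gcd (u * v) N = 1 ∧
    t = (v : ℝ) / (u : ℝ)}

/-! Write μ̂ for the Fourier transform of μ. By `isSpectrum_of_hasSum`, Λ is a spectrum as soon as
∑_{λ ∈ Λ} |μ̂(ξ + λ)|² = 1 for all real ξ. The core is `exists_common_spectrum`: for a finite set P
of integers coprime to N, a single Λ ⊆ ℤ has all dilations pΛ, p ∈ P, as spectra. Given t_i = v_i /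
u_i and U = ∏ u_i, both UΛ and t_i UΛ = v_i (U / u_i) Λ are such dilations. Adding the multiples of
these integers by (N + 1)^n, n < r, to P gives r distinct common spectra.

To build Λ, note that Galois conjugation preserves the vanishing sums behind the Hadamard condition
when frequencies are multiplied by p. Hence the one-digit Parseval identity `sum_norm_mask_sq` holds
for the same L and every p coprime to N. Iterating it along a tree of residue classes (n, a) gives
Parseval identities for the finite products approximating μ̂, for all p at once.

Passing to the limit requires a lower bound on the tails μ̂(p(ξ + a) / N^n). The representatives a
are free up to a common integer shift of the digits. Since #L < N, k digits produce at most (#L)^k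
points to protect, against N^k candidate shifts. For large k, some shift therefore moves all points
off the finitely many relevant zeros (`exists_shift`). Compactness makes the bound uniform, and
dominated convergence yields the Parseval identity of μ (`hasSum_norm_fourierSelfSimilar_sq`). -/

/-! ### Exponential sums and Galois conjugation -/

/-- The exponential `e^{2πi x}`. -/
noncomputable def unitExp (x : ℝ) : ℂ := Complex.exp (2 * Real.pi * Complex.I * (x : ℂ))

lemma unitExp_add (x y : ℝ) : unitExp (x + y) = unitExp x * unitExp y := by
  simp only [unitExp, ← Complex.exp_add]
  push_cast
  ring_nf

lemma unitExp_int (n : ℤ) : unitExp n = 1 := by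
  unfold unitExp
  rw [Complex.exp_eq_one_iff]
  exact ⟨n, by push_cast; ring⟩

lemma unitExp_zero : unitExp 0 = 1 := by simpa using unitExp_int 0

lemma norm_unitExp (x : ℝ) : ‖unitExp x‖ = 1 := by
  unfold unitExp
  rw [show (2 * Real.pi * Complex.I * (x : ℂ) : ℂ) = ((2 * Real.pi * x : ℝ) : ℂ) * Complex.I by
    push_cast; ring, Complex.norm_exp_ofReal_mul_I]

lemma star_unitExp (x : ℝ) : star (unitExp x) = unitExp (-x) := by
  unfold unitExp
  rw [Complex.star_def, ← Complex.exp_conj]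
  congr 1
  simp only [map_mul, Complex.conj_ofReal, Complex.conj_I, map_ofNat]
  push_cast
  ring

lemma unitExp_nat_mul (n : ℕ) (x : ℝ) : unitExp (n * x) = unitExp x ^ n := by
  simp only [unitExp, ← Complex.exp_nat_mul]
  push_cast
  ring_nf

lemma unitExp_div_eq_pow {n : ℕ} (hn : n ≠ 0) (k : ℤ) :
    unitExp (k / n) = unitExp (1 / n) ^ (k % n).toNat := by
  have hn' : (n : ℤ) ≠ 0 := by exact_mod_cast hn
  have h0 : (((k % n).toNat : ℕ) : ℤ) = k % n := Int.toNat_of_nonneg (Int.emod_nonneg _ hn')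
  have h1 : (k : ℝ) = n * (k / n : ℤ) + ((k % n).toNat : ℕ) := by
    have := Int.mul_ediv_add_emod k n
    rw [← h0] at this
    exact_mod_cast this.symm
  have h2 : (k / n : ℝ) = ((k / n : ℤ) : ℝ) + ((k % n).toNat : ℕ) * (1 / (n : ℝ)) := by
    rw [h1]
    have : (n : ℝ) ≠ 0 := by exact_mod_cast hn
    field_simp
  rw [h2, unitExp_add, unitExp_int, one_mul, unitExp_nat_mul]

/-- Galois conjugation: a vanishing sum of `n`-th roots of unity still vanishes after raising every
term to a power coprime to `n`. -/
lemma sum_unitExp_mul_eq_zero {n p : ℕ} (hn : n ≠ 0) (hp : p.Coprime n) (B : Finset ℤ) (a : ℤ)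
    (h : ∑ b ∈ B, unitExp ((b * a : ℤ) / n) = 0) :
    ∑ b ∈ B, unitExp ((b * (p * a) : ℤ) / n) = 0 := by
  let f : Polynomial ℤ := ∑ b ∈ B, Polynomial.X ^ ((b * a) % n).toNat
  have hζ : IsPrimitiveRoot (unitExp (1 / n)) n := by
    have := Complex.isPrimitiveRoot_exp n hn
    unfold unitExp
    convert this using 2
    push_cast
    ring
  have hf : Polynomial.aeval (unitExp (1 / n)) f = 0 := by
    simp only [f, map_sum, map_pow, Polynomial.aeval_X]
    rw [← h]
    exact Finset.sum_congr rfl fun b _ => (unitExp_div_eq_pow hn _).symm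
  -- Since p is coprime to n, ζ and ζ^p have the same minimal polynomial over ℤ, so f also vanishes
  -- at ζ^p.
  have hdvd := minpoly.isIntegrallyClosed_dvd (hζ.isIntegral (Nat.pos_of_ne_zero hn)) hf
  rw [hζ.minpoly_eq_pow_coprime hp] at hdvd
  have h0 : Polynomial.aeval (unitExp (1 / n) ^ p) f = 0 := by
    obtain ⟨g, hg⟩ := hdvd
    rw [hg, map_mul, minpoly.aeval, zero_mul]
  simp only [f, map_sum, map_pow, Polynomial.aeval_X] at h0
  rw [← h0]
  refine Finset.sum_congr rfl fun b _ => ?_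
  rw [pow_right_comm, ← unitExp_div_eq_pow hn, ← unitExp_nat_mul]
  congr 1
  push_cast
  ring

/-- The normalised exponential sum `(1 / #B) ∑_{b ∈ B} e^{2πi b x}`. -/
noncomputable def mask (B : Finset ℤ) (x : ℝ) : ℂ := (B.card : ℂ)⁻¹ * ∑ b ∈ B, unitExp (b * x)

lemma mask_zero {B : Finset ℤ} (hB : B.Nonempty) : mask B 0 = 1 := by
  have : (B.card : ℂ) ≠ 0 := by simpa using hB.ne_empty
  simp [mask, unitExp_zero, this]

lemma norm_mask_le (B : Finset ℤ) (x : ℝ) : ‖mask B x‖ ≤ 1 := by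
  unfold mask
  rw [norm_mul, norm_inv, Complex.norm_natCast]
  refine inv_mul_le_one_of_le₀ ((norm_sum_le _ _).trans ?_) (Nat.cast_nonneg _)
  simp [norm_unitExp]

lemma mask_add_int (B : Finset ℤ) (x : ℝ) (n : ℤ) : mask B (x + n) = mask B x := by
  unfold mask
  congr 1
  refine Finset.sum_congr rfl fun b _ => ?_
  rw [mul_add, unitExp_add, ← Int.cast_mul, unitExp_int, mul_one]

lemma analyticOnNhd_mask (B : Finset ℤ) : AnalyticOnNhd ℝ (mask B) Set.univ := by
  intro x _
  unfold mask unitExp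
  have h : ∀ b : ℤ, AnalyticAt ℝ (fun x : ℝ => ((b * x : ℝ) : ℂ)) x := fun b =>
    (Complex.ofRealCLM.analyticAt _).comp (analyticAt_const.mul analyticAt_id)
  refine analyticAt_const.mul (Finset.analyticAt_fun_sum _ fun b _ => ?_)
  have he : ∀ z : ℂ, AnalyticAt ℝ Complex.exp z := fun z => analyticAt_cexp.restrictScalars
  exact (he _).comp (analyticAt_const.mul (h b))

/-! ### Parseval identity for one digit, uniformly in dilations coprime to N -/

namespace IsHadamardTriple

variable {N : ℕ} {B L : Finset ℤ}

lemma nonempty_left (hT : IsHadamardTriple N B L) : B.Nonempty :=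
  Finset.card_pos.mp (by have := hT.two_le_card; omega)

lemma sum_unitExp_eq_zero (hT : IsHadamardTriple N B L) {l l' : ℤ} (hl : l ∈ L) (hl' : l' ∈ L)
    (hne : l ≠ l') : ∑ b ∈ B, unitExp ((b * (l' - l) : ℤ) / N) = 0 := by
  have h := congrFun (congrFun hT.unitary ⟨l, hl⟩) ⟨l', hl'⟩
  rw [Matrix.one_apply_ne (by simpa using hne), Matrix.mul_apply] at h
  have hB : (B.card : ℂ) ≠ 0 := by simpa using hT.nonempty_left.ne_empty
  have hs : ((Real.sqrt B.card : ℝ) : ℂ) * (Real.sqrt B.card : ℝ) = B.card := by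
    rw [← Complex.ofReal_mul, Real.mul_self_sqrt (Nat.cast_nonneg _)]
    simp
  have hterm : ∀ b : B, (hadamardMatrix N B L)ᴴ ⟨l, hl⟩ b * hadamardMatrix N B L b ⟨l', hl'⟩ =
      (B.card : ℂ)⁻¹ * unitExp (((b : ℤ) * (l' - l) : ℤ) / N) := by
    intro b
    have e : ∀ k : ℤ, Complex.exp (2 * Real.pi * Complex.I *
        (((b : ℤ) : ℂ) * (k : ℂ) / (N : ℂ))) = unitExp ((b : ℤ) * k / N) := by
      intro k
      unfold unitExp
      push_cast
      rfl
    rw [Matrix.conjTranspose_apply]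
    simp only [hadamardMatrix, Matrix.of_apply, e]
    rw [star_mul', star_unitExp, Complex.star_def, map_div₀, map_one, Complex.conj_ofReal,
      mul_mul_mul_comm, ← unitExp_add, div_mul_div_comm, hs, one_mul, one_div]
    congr 2
    push_cast
    ring
  simp only [hterm, ← Finset.mul_sum] at h
  rw [Finset.sum_coe_sort B (fun b : ℤ => unitExp ((b * (l' - l) : ℤ) / N))] at h
  exact (mul_eq_zero.mp h).resolve_left (inv_ne_zero hB)

/-- Conjugation keeps the columns of the dilated matrix orthogonal. The matrix is square, so its
left inverse is a right inverse and the rows are orthogonal too. -/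
lemma sum_unitExp_row (hT : IsHadamardTriple N B L) {p : ℕ} (hp : p.Coprime N) {b b' : ℤ}
    (hb : b ∈ B) (hb' : b' ∈ B) :
    ∑ l ∈ L, unitExp ((b - b') * (p * l) / N) = if b = b' then (B.card : ℂ) else 0 := by
  have hN : N ≠ 0 := by have := hT.two_le; omega
  have hB : (B.card : ℂ) ≠ 0 := by simpa using hT.nonempty_left.ne_empty
  let A : Matrix B L ℂ := Matrix.of fun b l => unitExp ((b : ℤ) * (p * (l : ℤ)) / N)
  have hA : ((B.card : ℂ)⁻¹ • Aᴴ) * A = 1 := by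
    ext l l'
    rw [Matrix.smul_mul, Matrix.smul_apply, Matrix.mul_apply, smul_eq_mul]
    have : ∀ b : B, Aᴴ l b * A b l' =
        unitExp (((b : ℤ) * (p * ((l' : ℤ) - (l : ℤ))) : ℤ) / N) := by
      intro b
      rw [Matrix.conjTranspose_apply]
      simp only [A, Matrix.of_apply]
      rw [star_unitExp, ← unitExp_add]
      congr 1
      push_cast
      ring
    simp only [this]
    rw [Finset.sum_coe_sort B
      (fun b : ℤ => unitExp ((b * (p * ((l' : ℤ) - (l : ℤ))) : ℤ) / N))]
    by_cases hl : l = l'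
    · subst hl
      simp [unitExp_zero, hB]
    · rw [sum_unitExp_mul_eq_zero hN hp _ _
        (hT.sum_unitExp_eq_zero l.2 l'.2 (fun h => hl (Subtype.ext h))),
        Matrix.one_apply_ne hl, mul_zero]
  rw [Matrix.mul_eq_one_comm_of_card_eq _ _ _ (by
    rw [Fintype.card_coe, Fintype.card_coe]; exact hT.card_eq.symm)] at hA
  have h := congrFun (congrFun hA ⟨b, hb⟩) ⟨b', hb'⟩
  rw [Matrix.mul_smul, Matrix.smul_apply, Matrix.mul_apply, smul_eq_mul, Matrix.one_apply] at h
  have : ∀ l : L, A ⟨b, hb⟩ l * Aᴴ l ⟨b', hb'⟩ = unitExp ((b - b') * (p * (l : ℤ)) / N) := by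
    intro l
    rw [Matrix.conjTranspose_apply]
    simp only [A, Matrix.of_apply]
    rw [star_unitExp, ← unitExp_add]
    congr 1
    ring
  simp only [this] at h
  rw [Finset.sum_coe_sort L (fun l : ℤ => unitExp ((b - b') * (p * l) / N)),
    inv_mul_eq_iff_eq_mul₀ hB] at h
  rw [h]
  simp

/-- After expanding the squares and summing over l, row orthogonality leaves only the terms b = b'.
That L does not depend on p is what lets one set serve all dilations. -/
lemma sum_norm_mask_sq (hT : IsHadamardTriple N B L) {p : ℕ} (hp : p.Coprime N) (y : ℝ) :
    ∑ l ∈ L, ‖mask B (p * (y + l) / N)‖ ^ 2 = 1 := by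
  have hB : (B.card : ℂ) ≠ 0 := by simpa using hT.nonempty_left.ne_empty
  have key : ∀ l : ℤ, ((‖mask B (p * (y + l) / N)‖ ^ 2 : ℝ) : ℂ) = ((B.card : ℂ)⁻¹) ^ 2 *
      ∑ b ∈ B, ∑ b' ∈ B, unitExp ((b - b') * (p * y / N)) *
        unitExp ((b - b') * (p * l) / N) := by
    intro l
    rw [Complex.ofReal_pow, ← Complex.mul_conj', ← Complex.star_def]
    simp only [mask]
    rw [star_mul', star_sum, star_inv₀, star_natCast, mul_mul_mul_comm, ← sq, Finset.sum_mul_sum]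
    congr 1
    refine Finset.sum_congr rfl fun b _ => Finset.sum_congr rfl fun b' _ => ?_
    rw [star_unitExp, ← unitExp_add, ← unitExp_add]
    congr 1
    ring
  have : ((∑ l ∈ L, ‖mask B (p * (y + l) / N)‖ ^ 2 : ℝ) : ℂ) = 1 := by
    rw [Complex.ofReal_sum]
    simp only [key]
    rw [← Finset.mul_sum, Finset.sum_comm]
    have h2 : ∀ b ∈ B, ∑ l ∈ L, ∑ b' ∈ B, unitExp ((b - b') * (p * y / N)) *
        unitExp ((b - b') * (p * l) / N) = B.card := by
      intro b hb
      rw [Finset.sum_comm]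
      simp only [← Finset.mul_sum]
      rw [Finset.sum_congr rfl fun b' hb' => by rw [hT.sum_unitExp_row hp hb hb']]
      simp [hb, unitExp_zero]
    rw [Finset.sum_congr rfl h2]
    simp only [Finset.sum_const, nsmul_eq_mul]
    field_simp
  exact_mod_cast this

end IsHadamardTriple

/-! ### Finite mask products -/

/-- The Fourier transform `ξ ↦ ∫ e^{2πi ξ x} dμ_{N,B}(x)`. -/
noncomputable def fourierSelfSimilar (N : ℕ) (B : Finset ℤ) (x : ℝ) : ℂ :=
  charFun (selfSimilarMeasure N B : Measure ℝ) (2 * Real.pi * x)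

/-- The Fourier transform of the `n`-th discrete approximation of `μ_{N,B}`. -/
noncomputable def maskProd (N : ℕ) (B : Finset ℤ) (n : ℕ) (x : ℝ) : ℂ :=
  ∏ j ∈ Finset.range n, mask B (x / (N : ℝ) ^ (j + 1))

section MaskProd

variable {N : ℕ} {B : Finset ℤ}

lemma maskProd_succ (n : ℕ) (x : ℝ) :
    maskProd N B (n + 1) x = mask B (x / N) * maskProd N B n (x / N) := by
  unfold maskProd
  rw [Finset.prod_range_succ', mul_comm]
  congr 1
  · simp
  · refine Finset.prod_congr rfl fun j _ => ?_
    rw [div_div, ← pow_succ']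

lemma maskProd_add (n k : ℕ) (x : ℝ) :
    maskProd N B (n + k) x = maskProd N B n x * maskProd N B k (x / (N : ℝ) ^ n) := by
  unfold maskProd
  rw [Finset.prod_range_add]
  congr 1
  refine Finset.prod_congr rfl fun j _ => ?_
  rw [div_div, ← pow_add, add_assoc]

lemma maskProd_zero_right (hB : B.Nonempty) (n : ℕ) : maskProd N B n 0 = 1 := by
  simp [maskProd, mask_zero hB]

/-- The factor of index j has period N^(j+1), which divides N^n: level n only sees residues modulo
N^n. -/
lemma maskProd_add_int_mul_pow (hN : N ≠ 0) (n : ℕ) (x : ℝ) (d : ℤ) :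
    maskProd N B n (x + (N : ℝ) ^ n * d) = maskProd N B n x := by
  unfold maskProd
  refine Finset.prod_congr rfl fun j hj => ?_
  have hj' : j + 1 ≤ n := Finset.mem_range.mp hj
  have hN' : (N : ℝ) ≠ 0 := by exact_mod_cast hN
  obtain ⟨i, rfl⟩ := Nat.exists_eq_add_of_le hj'
  rw [← mask_add_int B (x / (N : ℝ) ^ (j + 1)) ((N : ℤ) ^ i * d), add_div, pow_add _ (j + 1) i,
    mul_assoc, mul_div_cancel_left₀ _ (pow_ne_zero _ hN')]
  push_cast
  rfl

lemma analyticOnNhd_maskProd (n : ℕ) : AnalyticOnNhd ℝ (maskProd N B n) Set.univ := by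
  intro x _
  unfold maskProd
  refine Finset.analyticAt_fun_prod _ fun j _ => ?_
  have : AnalyticAt ℝ (fun x : ℝ => x / (N : ℝ) ^ (j + 1)) x := by
    simp only [div_eq_mul_inv]
    exact analyticAt_id.mul analyticAt_const
  exact AnalyticAt.fun_comp (analyticOnNhd_mask B _ trivial) this

/-- The product is real analytic and equals 1 at 0, so its zeros are isolated. -/
lemma finite_zeros_maskProd (hB : B.Nonempty) (n : ℕ) (C : ℝ) :
    {x : ℝ | |x| ≤ C ∧ maskProd N B n x = 0}.Finite := by
  have h := (analyticOnNhd_maskProd (N := N) (B := B) n).preimage_zero_mem_codiscrete (x := 0)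
    (by rw [maskProd_zero_right hB]; exact one_ne_zero)
  have hf := (isCompact_Icc (a := -C) (b := C)).finite_sdiff_of_mem_codiscreteWithin
    (Filter.codiscreteWithin_mono (Set.subset_univ _) h)
  refine hf.subset ?_
  rintro x ⟨hx, h0⟩
  exact ⟨abs_le.mp hx, by simpa using h0⟩

end MaskProd

/-! ### The Fourier transform as a limit of mask products, and its zeros -/

section FourierSelfSimilar

variable {N : ℕ} {B : Finset ℤ}

lemma fourierSelfSimilar_zero : fourierSelfSimilar N B 0 = 1 := by simp [fourierSelfSimilar]

lemma norm_fourierSelfSimilar_le (x : ℝ) : ‖fourierSelfSimilar N B x‖ ≤ 1 :=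
  norm_charFun_le_one _

lemma continuous_fourierSelfSimilar : Continuous (fourierSelfSimilar N B) := by
  unfold fourierSelfSimilar
  fun_prop

lemma fourierSelfSimilar_eq_mask_mul (hN : 2 ≤ N) (hB : B.Nonempty) (x : ℝ) :
    fourierSelfSimilar N B x = mask B (x / N) * fourierSelfSimilar N B (x / N) := by
  unfold fourierSelfSimilar
  rw [charFun_of_isSelfSimilar (isSelfSimilar_selfSimilarMeasure hN hB), mul_div_assoc]
  congr 1
  unfold mask unitExp
  congr 1
  refine Finset.sum_congr rfl fun b _ => ?_
  congr 1
  push_cast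
  ring

lemma fourierSelfSimilar_eq_maskProd_mul (hN : 2 ≤ N) (hB : B.Nonempty) (n : ℕ) (x : ℝ) :
    fourierSelfSimilar N B x =
      maskProd N B n x * fourierSelfSimilar N B (x / (N : ℝ) ^ n) := by
  induction n generalizing x with
  | zero => simp [maskProd]
  | succ n ih =>
    rw [fourierSelfSimilar_eq_mask_mul hN hB, ih, maskProd_succ, mul_assoc, div_div, pow_succ']

lemma norm_fourierSelfSimilar_le_norm_maskProd (hN : 2 ≤ N) (hB : B.Nonempty) (n : ℕ) (x : ℝ) :
    ‖fourierSelfSimilar N B x‖ ≤ ‖maskProd N B n x‖ := by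
  rw [fourierSelfSimilar_eq_maskProd_mul hN hB n, norm_mul]
  exact mul_le_of_le_one_right (norm_nonneg _) (norm_fourierSelfSimilar_le _)

lemma norm_fourierSelfSimilar_le_div (hN : 2 ≤ N) (hB : B.Nonempty) (x : ℝ) :
    ‖fourierSelfSimilar N B x‖ ≤ ‖fourierSelfSimilar N B (x / N)‖ := by
  rw [fourierSelfSimilar_eq_mask_mul hN hB, norm_mul]
  exact mul_le_of_le_one_left (norm_nonneg _) (norm_mask_le _ _)

lemma tendsto_div_pow_atTop {ι : Type*} {l : Filter ι} (hN : 2 ≤ N) {n : ι → ℕ}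
    (hn : Filter.Tendsto n l Filter.atTop) (x : ℝ) :
    Filter.Tendsto (fun i => x / (N : ℝ) ^ n i) l (nhds 0) := by
  have : Filter.Tendsto (fun k : ℕ => (N : ℝ) ^ k) Filter.atTop Filter.atTop :=
    tendsto_pow_atTop_atTop_of_one_lt (by exact_mod_cast hN)
  exact (this.comp hn).const_div_atTop x

lemma tendsto_maskProd {ι : Type*} {l : Filter ι} (hN : 2 ≤ N) (hB : B.Nonempty) {n : ι → ℕ}
    (hn : Filter.Tendsto n l Filter.atTop) (x : ℝ) :
    Filter.Tendsto (fun i => maskProd N B (n i) x) l (nhds (fourierSelfSimilar N B x)) := by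
  have h1 : Filter.Tendsto (fun i => fourierSelfSimilar N B (x / (N : ℝ) ^ n i)) l (nhds 1) := by
    rw [← fourierSelfSimilar_zero (N := N) (B := B)]
    exact (continuous_fourierSelfSimilar.tendsto 0).comp (tendsto_div_pow_atTop hN hn x)
  -- The finite product is the transform divided by its tail, and the tail tends to 1.
  have h2 := (tendsto_const_nhds (x := fourierSelfSimilar N B x)).div h1 one_ne_zero
  rw [div_one] at h2
  refine h2.congr' ?_
  filter_upwards [h1.eventually_ne one_ne_zero] with i hi
  rw [Pi.div_apply, div_eq_iff hi]
  exact fourierSelfSimilar_eq_maskProd_mul hN hB _ _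

/-- For n large, x / N^n lies where the transform is nonzero for all |x| ≤ C, so every zero comes
from the finite product. -/
lemma finite_zeros_fourierSelfSimilar (hN : 2 ≤ N) (hB : B.Nonempty) (C : ℝ) :
    {x : ℝ | |x| ≤ C ∧ fourierSelfSimilar N B x = 0}.Finite := by
  have h0 : ∀ᶠ y in nhds (0 : ℝ), fourierSelfSimilar N B y ≠ 0 :=
    continuous_fourierSelfSimilar.continuousAt.eventually_ne
      (by rw [fourierSelfSimilar_zero]; exact one_ne_zero)
  obtain ⟨r, hr, hr0⟩ := Metric.eventually_nhds_iff.mp h0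
  obtain ⟨n, hn⟩ := ((tendsto_div_pow_atTop hN Filter.tendsto_id C).eventually
    (gt_mem_nhds hr)).exists
  refine (finite_zeros_maskProd (N := N) hB n C).subset ?_
  rintro x ⟨hx, hx0⟩
  refine ⟨hx, ?_⟩
  rw [fourierSelfSimilar_eq_maskProd_mul hN hB n] at hx0
  refine (mul_eq_zero.mp hx0).resolve_right (hr0 ?_)
  have hp : (0 : ℝ) < (N : ℝ) ^ n := by positivity
  rw [dist_zero_right, Real.norm_eq_abs, abs_div, abs_of_pos hp]
  exact (div_le_div_of_nonneg_right hx hp.le).trans_lt hn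

end FourierSelfSimilar

/-! ### Parseval identity for several digits -/

/-- The sums `∑_{i < k} N ^ i * l_i` of `k` digits `l_i ∈ L`, with multiplicity. -/
def digitSums (N : ℕ) (L : Finset ℤ) : ℕ → Multiset ℤ
  | 0 => {0}
  | k + 1 => L.val.bind fun l => (digitSums N L k).map fun d => l + N * d

section DigitSums

variable {N : ℕ} {B L : Finset ℤ}

lemma card_digitSums (k : ℕ) : (digitSums N L k).card = L.card ^ k := by
  induction k with
  | zero => rfl
  | succ k ih => simp [digitSums, Multiset.card_bind, ih, pow_succ']

lemma abs_le_of_mem_digitSums (hN : 2 ≤ N) {R : ℤ} (hR : 0 ≤ R) (hL : ∀ l ∈ L, |l| ≤ R) {k : ℕ}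
    {d : ℤ} (hd : d ∈ digitSums N L k) : |d| ≤ R * ((N : ℤ) ^ k - 1) := by
  induction k generalizing d with
  | zero => simp_all [digitSums]
  | succ k ih =>
    simp only [digitSums, Multiset.mem_bind, Multiset.mem_map] at hd
    obtain ⟨l, hl, d', hd', rfl⟩ := hd
    have h1 := hL l hl
    have h2 := ih hd'
    have hN' : (2 : ℤ) ≤ N := by exact_mod_cast hN
    calc |l + N * d'| ≤ |l| + |(N : ℤ) * d'| := abs_add_le _ _
      _ = |l| + N * |d'| := by rw [abs_mul, Nat.abs_cast]
      _ ≤ R + N * (R * ((N : ℤ) ^ k - 1)) := by gcongr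
      _ ≤ R * ((N : ℤ) ^ (k + 1) - 1) := by
        rw [pow_succ]
        nlinarith

/-- Induction on k: for each first digit the later digits contribute total weight 1. Validity at
every y is what later permits shifting all digit sums by one integer. -/
lemma sum_digitSums_norm_maskProd_sq (hN : N ≠ 0) {p : ℕ}
    (hL : ∀ y : ℝ, ∑ l ∈ L, ‖mask B (p * (y + l) / N)‖ ^ 2 = 1) (k : ℕ) (y : ℝ) :
    ((digitSums N L k).map fun d : ℤ => ‖maskProd N B k (p * (y + d))‖ ^ 2).sum = 1 := by
  induction k generalizing y with
  | zero => simp [digitSums, maskProd]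
  | succ k ih =>
    have hN' : (N : ℝ) ≠ 0 := by exact_mod_cast hN
    rw [digitSums, Multiset.map_bind, Multiset.sum_bind, ← hL y]
    change _ = (L.val.map _).sum
    congr 1
    refine Multiset.map_congr rfl fun l _ => ?_
    rw [Multiset.map_map, ← mul_one (‖mask B (p * (y + l) / N)‖ ^ 2), ← ih ((y + l) / N),
      ← Multiset.sum_map_mul_left]
    congr 1
    refine Multiset.map_congr rfl fun d _ => ?_
    rw [Function.comp_apply, maskProd_succ, norm_mul, mul_pow]
    have : (p * (y + ((l + N * d : ℤ) : ℝ)) / N : ℝ) = p * ((y + l) / N + d) := by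
      push_cast
      field_simp
      ring
    rw [this]
    congr 3
    rw [← mask_add_int B (p * (y + l) / N) (p * d)]
    congr 1
    push_cast
    ring

end DigitSums

/-! ### Shifting digits away from the zeros -/

section Shift

variable {N : ℕ} {B L : Finset ℤ} {P : Finset ℕ}

lemma finite_zeros_dilated_fourierSelfSimilar (hN : 2 ≤ N) (hB : B.Nonempty)
    (hP : ∀ p ∈ P, 0 < p) (C : ℝ) :
    {x : ℝ | |x| ≤ C ∧ ∃ p ∈ P, fourierSelfSimilar N B (p * x) = 0}.Finite := by
  have h : (⋃ p ∈ P, (fun x : ℝ => (p : ℝ) * x) ⁻¹'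
      {x : ℝ | |x| ≤ p * C ∧ fourierSelfSimilar N B x = 0}).Finite := by
    refine P.finite_toSet.biUnion fun p hp => ?_
    have hp0 : (p : ℝ) ≠ 0 := by exact_mod_cast (hP p hp).ne'
    exact (finite_zeros_fourierSelfSimilar hN hB _).preimage (mul_right_injective₀ hp0).injOn
  refine h.subset ?_
  rintro x ⟨hx, p, hp, h0⟩
  simp only [Set.mem_iUnion, Set.mem_preimage, Set.mem_ofPred_eq]
  refine ⟨p, hp, ?_, h0⟩
  rw [abs_mul, Nat.abs_cast]
  gcongr

lemma exists_mul_pow_lt_pow {a b : ℕ} (hab : a < b) (s : ℕ) : ∃ k, s * a ^ k < b ^ k := by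
  have hb : (0 : ℝ) < b := by exact_mod_cast (Nat.zero_le a).trans_lt hab
  have h1 : (a / b : ℝ) < 1 := (div_lt_one hb).mpr (by exact_mod_cast hab)
  obtain ⟨k, hk⟩ := exists_pow_lt_of_lt_one (show (0 : ℝ) < 1 / (s + 1) by positivity) h1
  refine ⟨k, ?_⟩
  rw [div_pow, div_lt_div_iff₀ (by positivity) (by positivity), one_mul] at hk
  have : (s * a ^ k : ℝ) < b ^ k :=
    lt_of_le_of_lt (by nlinarith [pow_nonneg (Nat.cast_nonneg (α := ℝ) a) k]) hk
  exact_mod_cast this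

/-- If `#D * #S < K`, some translate of `(y + D) / K` by `c / K`, `c < K`, misses `S`. -/
lemma exists_translate_notMem (D : Finset ℤ) (S : Finset ℝ) {K : ℕ} (hK : D.card * S.card < K)
    (y : ℝ) : ∃ c < K, ∀ d ∈ D, (y + d + c) / K ∉ S := by
  by_contra! h
  have hK0 : (K : ℝ) ≠ 0 := by
    have : K ≠ 0 := by omega
    exact_mod_cast this
  -- Pigeonhole: a pair (d, element of S) determines c, so at most #D * #S shifts are bad.
  choose! f hf hfS using h
  obtain ⟨c, hc, c', hc', hne, heq⟩ := Finset.exists_ne_map_eq_of_card_lt_of_maps_to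
    (s := Finset.range K) (t := D ×ˢ S) (by simpa using hK)
    (f := fun c => (f c, (y + f c + c) / K)) (fun c hc => by
      have hc' := Finset.mem_range.mp hc
      exact Finset.mem_product.mpr ⟨hf c hc', hfS c hc'⟩)
  rw [Prod.mk.injEq] at heq
  rw [heq.1, div_left_inj' hK0, add_right_inj] at heq
  exact hne (by exact_mod_cast heq.2)

lemma Finset.prod_le_of_mem {ι : Type*} {s : Finset ι} {f : ι → ℝ} (h0 : ∀ i ∈ s, 0 ≤ f i)
    (h1 : ∀ i ∈ s, f i ≤ 1) {i : ι} (hi : i ∈ s) : ∏ j ∈ s, f j ≤ f i := by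
  classical
  rw [← Finset.mul_prod_erase s f hi]
  exact mul_le_of_le_one_right (h0 i hi) (Finset.prod_le_one
    (fun j hj => h0 j (Finset.mem_of_mem_erase hj)) fun j hj => h1 j (Finset.mem_of_mem_erase hj))

/-- As #L < N, for some k the number N^k of shifts exceeds (#L)^k times the number of zeros, so each
y has a shift avoiding all of them. Compactness of [-Y, Y] turns this into one ε. -/
lemma exists_shift (hN : 2 ≤ N) (hB : B.Nonempty) (hLN : L.card < N) (hP : ∀ p ∈ P, 0 < p)
    {R : ℤ} (hR : 0 ≤ R) (hL : ∀ l ∈ L, |l| ≤ R) {Y : ℝ} (hY : 0 ≤ Y) :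
    ∃ k : ℕ, ∃ ε : ℝ, 0 < ε ∧ ∀ y : ℝ, |y| ≤ Y → ∃ c : ℕ, c < N ^ k ∧ ∀ d ∈ digitSums N L k,
      ∀ p ∈ P, ε ≤ ‖fourierSelfSimilar N B (p * ((y + d + c) / (N : ℝ) ^ k))‖ := by
  classical
  -- The window of radius Y + R + 1 contains all points (y + d + c) / N^k.
  have hS := finite_zeros_dilated_fourierSelfSimilar (N := N) hN hB hP (Y + R + 1)
  obtain ⟨k, hk⟩ := exists_mul_pow_lt_pow hLN hS.toFinset.card
  have hNk : (1 : ℝ) ≤ (N : ℝ) ^ k := one_le_pow₀ (by exact_mod_cast (by omega : 1 ≤ N))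
  have hNk0 : (0 : ℝ) < (N : ℝ) ^ k := by linarith
  let D := (digitSums N L k).toFinset
  let G : ℕ → ℝ → ℝ := fun c y =>
    ∏ i ∈ D ×ˢ P, ‖fourierSelfSimilar N B (i.2 * ((y + i.1 + c) / (N : ℝ) ^ k))‖
  have hGc : ∀ c, Continuous (G c) := fun c =>
    continuous_finsetProd _ fun i _ =>
      (continuous_fourierSelfSimilar.comp (by fun_prop)).norm
  have hG0 : ∀ c y, 0 ≤ G c y := fun c y => Finset.prod_nonneg fun _ _ => norm_nonneg _
  have hpos : ∀ y ∈ Set.Icc (-Y) Y, 0 < ∑ c ∈ Finset.range (N ^ k), G c y := by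
    intro y hy
    have hD : D.card * hS.toFinset.card < N ^ k := by
      refine lt_of_le_of_lt ?_ hk
      rw [mul_comm]
      gcongr
      exact (Multiset.toFinset_card_le _).trans (card_digitSums k).le
    obtain ⟨c, hc, hcD⟩ := exists_translate_notMem D hS.toFinset hD y
    refine Finset.sum_pos' (fun c _ => hG0 c y) ⟨c, Finset.mem_range.mpr hc, ?_⟩
    refine Finset.prod_pos fun i hi => ?_
    obtain ⟨hi1, hi2⟩ := Finset.mem_product.mp hi
    have h := hcD i.1 hi1
    rw [Set.Finite.mem_toFinset, Set.mem_ofPred_eq] at h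
    push Not at h
    push_cast at h
    refine norm_pos_iff.mpr (h ?_ i.2 hi2)
    have h1 : |((i.1 : ℤ) : ℝ)| ≤ R * ((N : ℝ) ^ k - 1) := by
      exact_mod_cast abs_le_of_mem_digitSums hN hR hL (Multiset.mem_toFinset.mp hi1)
    have h2 : (c : ℝ) ≤ (N : ℝ) ^ k := by exact_mod_cast hc.le
    have h3 : |y| ≤ Y := abs_le.mpr hy
    have hR' : (0 : ℝ) ≤ R := by exact_mod_cast hR
    rw [abs_div, abs_of_pos hNk0, div_le_iff₀ hNk0]
    calc |y + i.1 + c| ≤ |y| + |((i.1 : ℤ) : ℝ)| + |(c : ℝ)| := abs_add_three _ _ _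
      _ ≤ Y + R * ((N : ℝ) ^ k - 1) + (N : ℝ) ^ k := by
        rw [Nat.abs_cast]
        gcongr
      _ ≤ (Y + R + 1) * (N : ℝ) ^ k := by nlinarith
  obtain ⟨y₀, hy₀, hmin⟩ := (isCompact_Icc (a := -Y) (b := Y)).exists_isMinOn
    ⟨0, by simpa using hY⟩ (continuous_finsetSum _ fun c _ => hGc c).continuousOn
  -- The sum over shifts, unlike a choice of shift, is continuous in y, so it has a positive
  -- minimum. Some shift attains at least the average, and since all factors are at most 1, each
  -- factor is at least the product.
  refine ⟨k, (∑ c ∈ Finset.range (N ^ k), G c y₀) / (N : ℝ) ^ k, div_pos (hpos _ hy₀) hNk0, ?_⟩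
  intro y hy
  have hle : ∑ c ∈ Finset.range (N ^ k), (∑ c ∈ Finset.range (N ^ k), G c y₀) / (N : ℝ) ^ k ≤
      ∑ c ∈ Finset.range (N ^ k), G c y := by
    rw [Finset.sum_const, Finset.card_range, nsmul_eq_mul]
    push_cast
    rw [mul_div_cancel₀ _ hNk0.ne']
    exact hmin (abs_le.mp hy)
  obtain ⟨c, hc, hcle⟩ := Finset.exists_le_of_sum_le
    ⟨0, Finset.mem_range.mpr (by positivity)⟩ hle
  refine ⟨c, Finset.mem_range.mp hc, fun d hd p hp => hcle.trans ?_⟩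
  exact Finset.prod_le_of_mem
    (f := fun i : ℤ × ℕ => ‖fourierSelfSimilar N B (i.2 * ((y + i.1 + c) / (N : ℝ) ^ k))‖)
    (fun _ _ => norm_nonneg _) (fun _ _ => norm_fourierSelfSimilar_le _)
    (i := (d, p)) (Finset.mk_mem_product (Multiset.mem_toFinset.mpr hd) hp)

end Shift

/-! ### The tree of residue classes -/

section Tree

variable {N : ℕ} {B L : Finset ℤ} {P : Finset ℕ}

/-- The children of a node `(n, a)`, which stands for the residue class of `a` modulo `N ^ n`. The
class of `a` itself is followed one level down; every other digit `l ∈ L` is followed by `k` more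
levels, along digits shifted by `c`. -/
noncomputable def nodeChildren (N : ℕ) (L : Finset ℤ) (k : ℕ) (c : ℝ → ℕ) (w : ℕ × ℤ) :
    Multiset (ℕ × ℤ) :=
  (w.1 + 1, w.2) ::ₘ (L.erase 0).val.bind fun l => (digitSums N L k).map fun d =>
    (w.1 + 1 + k, w.2 + (N : ℤ) ^ w.1 * (l + N * (d + c ((w.2 / (N : ℝ) ^ w.1 + l) / N))))

/-- The nodes of depth `g` in the tree generated by `nodeChildren` from the root `(0, 0)`. -/
noncomputable def treeNodes (N : ℕ) (L : Finset ℤ) (k : ℕ) (c : ℝ → ℕ) : ℕ → Multiset (ℕ × ℤ)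
  | 0 => {(0, 0)}
  | g + 1 => (treeNodes N L k c g).bind (nodeChildren N L k c)

/-- The weight of a class is split first along the digits of L and then along k further digits. The
shift c only moves the base point of the k-digit identity, so no weight is lost. -/
lemma sum_nodeChildren (hN : N ≠ 0) {p : ℕ}
    (hL : ∀ y : ℝ, ∑ l ∈ L, ‖mask B (p * (y + l) / N)‖ ^ 2 = 1) (h0 : 0 ∈ L) (k : ℕ) (c : ℝ → ℕ)
    (ξ : ℝ) (w : ℕ × ℤ) :
    ((nodeChildren N L k c w).map fun v => ‖maskProd N B v.1 (p * (ξ + v.2))‖ ^ 2).sum =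
      ‖maskProd N B w.1 (p * (ξ + w.2))‖ ^ 2 := by
  obtain ⟨n, a⟩ := w
  have hN' : (N : ℝ) ≠ 0 := by exact_mod_cast hN
  set A := ‖maskProd N B n (p * (ξ + a))‖ ^ 2 with hA
  set y : ℝ := (ξ + a) / (N : ℝ) ^ n with hy
  have hone : ∀ x : ℝ, maskProd N B 1 x = mask B (x / N) := by simp [maskProd]
  have hfirst : ‖maskProd N B (n + 1) (p * (ξ + a))‖ ^ 2 =
      A * ‖mask B (p * (y + (0 : ℤ)) / N)‖ ^ 2 := by
    rw [maskProd_add, norm_mul, mul_pow, hone, Int.cast_zero, add_zero, hy, mul_div_assoc]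
  have hrest : ∀ l : ℤ, ∀ e : ℕ, ((digitSums N L k).map fun d : ℤ =>
      ‖maskProd N B (n + 1 + k)
        (p * (ξ + ((a + (N : ℤ) ^ n * (l + N * (d + e)) : ℤ) : ℝ)))‖ ^ 2).sum =
      A * ‖mask B (p * (y + l) / N)‖ ^ 2 := by
    intro l e
    rw [← mul_one (A * _), ← sum_digitSums_norm_maskProd_sq hN hL k ((y + l) / N + e),
      ← Multiset.sum_map_mul_left]
    congr 1
    refine Multiset.map_congr rfl fun d _ => ?_
    have e1 : (p * (ξ + ((a + (N : ℤ) ^ n * (l + N * (d + e)) : ℤ) : ℝ)) : ℝ) =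
        p * (ξ + a) + (N : ℝ) ^ n * ((p * (l + N * (d + e)) : ℤ) : ℝ) := by
      push_cast
      ring
    have e2 : (p * (ξ + ((a + (N : ℤ) ^ n * (l + N * (d + e)) : ℤ) : ℝ)) : ℝ) / (N : ℝ) ^ n =
        p * (y + (l + N * (d + e))) := by
      rw [e1, hy]
      push_cast
      field_simp
    have e3 : (p * (y + (l + N * (d + e))) / N : ℝ) = p * ((y + l) / N + e + d) := by
      field_simp
      ring
    have e4 : (p * ((y + l) / N + e + d) : ℝ) = p * (y + l) / N + ((p * (e + d) : ℤ) : ℝ) := by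
      push_cast
      ring
    rw [add_assoc n 1 k, maskProd_add, e2, add_comm 1 k, maskProd_succ, e3, e1,
      maskProd_add_int_mul_pow hN, norm_mul, norm_mul, mul_pow, mul_pow, ← mul_assoc, ← hA,
      e4, mask_add_int, ← e4]
  rw [nodeChildren, Multiset.map_cons, Multiset.sum_cons, Multiset.map_bind, Multiset.sum_bind]
  simp only [Multiset.map_map, Function.comp_def]
  rw [hfirst]
  simp only [hrest]
  change _ + ∑ l ∈ L.erase 0, A * ‖mask B (p * (y + l) / N)‖ ^ 2 = _
  rw [Finset.add_sum_erase L (fun l : ℤ => A * ‖mask B (p * (y + l) / N)‖ ^ 2) h0,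
    ← Finset.mul_sum, hL, mul_one]

lemma sum_treeNodes (hN : N ≠ 0) {p : ℕ}
    (hL : ∀ y : ℝ, ∑ l ∈ L, ‖mask B (p * (y + l) / N)‖ ^ 2 = 1) (h0 : 0 ∈ L) (k : ℕ) (c : ℝ → ℕ)
    (g : ℕ) (ξ : ℝ) :
    ((treeNodes N L k c g).map fun v => ‖maskProd N B v.1 (p * (ξ + v.2))‖ ^ 2).sum = 1 := by
  induction g with
  | zero => simp [treeNodes, maskProd]
  | succ g ih =>
    rw [treeNodes, Multiset.map_bind, Multiset.sum_bind]
    simp only [sum_nodeChildren hN hL h0, ih]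

lemma mem_treeNodes_succ {k : ℕ} {c : ℝ → ℕ} {g n : ℕ} {a : ℤ}
    (h : (n, a) ∈ treeNodes N L k c g) : (n + 1, a) ∈ treeNodes N L k c (g + 1) := by
  rw [treeNodes, Multiset.mem_bind]
  exact ⟨_, h, Multiset.mem_cons_self _ _⟩

lemma le_fst_of_mem_treeNodes {k : ℕ} {c : ℝ → ℕ} {g : ℕ} {w : ℕ × ℤ}
    (h : w ∈ treeNodes N L k c g) : g ≤ w.1 := by
  induction g generalizing w with
  | zero => exact Nat.zero_le _
  | succ g ih =>
    rw [treeNodes, Multiset.mem_bind] at h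
    obtain ⟨v, hv, hw⟩ := h
    have := ih hv
    simp only [nodeChildren, Multiset.mem_cons, Multiset.mem_bind, Multiset.mem_map] at hw
    rcases hw with rfl | ⟨l, _, d, _, rfl⟩
    · exact Nat.succ_le_succ this
    · change g + 1 ≤ v.1 + 1 + k
      omega

/-- The tree can be chosen so that the dilated Fourier transforms stay bounded away from zero at all
its points `a / N ^ n`, which stay in a bounded set. -/
lemma exists_tree_bound (hN : 2 ≤ N) (hB : B.Nonempty) (hLN : L.card < N)
    (hP : ∀ p ∈ P, 0 < p) : ∃ k : ℕ, ∃ c : ℝ → ℕ, ∃ C ε : ℝ, 0 < ε ∧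
      ∀ g, ∀ w ∈ treeNodes N L k c g, |w.2 / (N : ℝ) ^ w.1| ≤ C ∧
        ∀ p ∈ P, ε ≤ ‖fourierSelfSimilar N B (p * (w.2 / (N : ℝ) ^ w.1))‖ := by
  let R : ℤ := ∑ l ∈ L, |l|
  have hR : 0 ≤ R := Finset.sum_nonneg fun _ _ => abs_nonneg _
  have hL : ∀ l ∈ L, |l| ≤ R := fun l hl =>
    Finset.single_le_sum (f := fun l : ℤ => |l|) (fun _ _ => abs_nonneg _) hl
  have hR' : (0 : ℝ) ≤ R := by exact_mod_cast hR
  have hN2 : (2 : ℝ) ≤ N := by exact_mod_cast hN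
  have hN0 : (0 : ℝ) < N := by linarith
  -- C is large enough to reproduce itself: y = (x + l) / N has |y| ≤ (C + R) / 2, and then (C + R)
  -- / 2 + R (N^k - 1) + N^k ≤ C N^k.
  set C : ℝ := 3 * R + 2 with hC
  obtain ⟨k, ε, hε, hk⟩ := exists_shift (B := B) hN hB hLN hP hR hL
    (show (0 : ℝ) ≤ (C + R) / 2 by positivity)
  choose! c hcN hc using hk
  have hNk : (1 : ℝ) ≤ (N : ℝ) ^ k := one_le_pow₀ (by linarith)
  have hNk0 : (0 : ℝ) < (N : ℝ) ^ k := by linarith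
  -- The minimum with 1 covers the root, whose point 0 has transform 1.
  refine ⟨k, c, C, min ε 1, lt_min hε one_pos, fun g => ?_⟩
  induction g with
  | zero =>
    intro w hw
    simp only [treeNodes, Multiset.mem_singleton] at hw
    subst hw
    simp only [Int.cast_zero, zero_div, abs_zero, mul_zero, fourierSelfSimilar_zero, norm_one]
    exact ⟨by positivity, fun _ _ => min_le_right _ _⟩
  | succ g ih =>
    intro w hw
    rw [treeNodes, Multiset.mem_bind] at hw
    obtain ⟨v, hv, hw⟩ := hw
    obtain ⟨hvC, hvε⟩ := ih v hv
    simp only [nodeChildren, Multiset.mem_cons, Multiset.mem_bind, Multiset.mem_map] at hw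
    rcases hw with rfl | ⟨l, hl, d, hd, rfl⟩
    -- The unshifted child moves the point x to x / N, where the modulus of the transform is no
    -- smaller.
    · have e : (v.2 / (N : ℝ) ^ (v.1 + 1) : ℝ) = v.2 / (N : ℝ) ^ v.1 / N := by
        rw [pow_succ, div_div]
      simp only [e]
      refine ⟨?_, fun p hp => (hvε p hp).trans ?_⟩
      · rw [abs_div, abs_of_pos hN0]
        exact (div_le_self (abs_nonneg _) (by linarith)).trans hvC
      · rw [← mul_div_assoc (p : ℝ) _ (N : ℝ)]
        exact norm_fourierSelfSimilar_le_div hN hB _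
    · set x : ℝ := v.2 / (N : ℝ) ^ v.1 with hx
      set y : ℝ := (x + l) / N with hy
      have hlR : |(l : ℝ)| ≤ R := by
        exact_mod_cast hL l (Finset.mem_of_mem_erase (Finset.mem_def.mpr hl))
      have hyY : |y| ≤ (C + R) / 2 := by
        rw [hy, abs_div, abs_of_pos hN0]
        refine div_le_div₀ (by positivity) ((abs_add_le _ _).trans (add_le_add hvC hlR))
          two_pos hN2
      have e : (((v.2 + (N : ℤ) ^ v.1 * (l + N * (d + c y)) : ℤ) : ℝ) /
          (N : ℝ) ^ (v.1 + 1 + k) : ℝ) = (y + d + c y) / (N : ℝ) ^ k := by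
        rw [hy, hx, pow_add, pow_succ]
        push_cast
        field_simp
        ring
      simp only [e]
      refine ⟨?_, fun p hp => (min_le_left _ _).trans (hc y hyY d hd p hp)⟩
      have h1 : |(d : ℝ)| ≤ R * ((N : ℝ) ^ k - 1) := by
        exact_mod_cast abs_le_of_mem_digitSums hN hR hL hd
      have h2 : (c y : ℝ) ≤ (N : ℝ) ^ k := by exact_mod_cast (hcN y hyY).le
      rw [abs_div, abs_of_pos hNk0, div_le_iff₀ hNk0]
      calc |y + d + c y| ≤ |y| + |(d : ℝ)| + |(c y : ℝ)| := abs_add_three _ _ _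
        _ ≤ (C + R) / 2 + R * ((N : ℝ) ^ k - 1) + (N : ℝ) ^ k := by
          rw [Nat.abs_cast]
          gcongr
        _ ≤ C * (N : ℝ) ^ k := by
          rw [hC]
          nlinarith

end Tree

/-! ### Passage to the limit in the Parseval identity -/

section Limit

variable {N : ℕ} {B : Finset ℤ} {p : ℕ}

/-- At ξ = -a every occurrence of a contributes 1 to a sum of nonnegative terms equal to 1. -/
lemma nodup_map_snd_of_sum_eq_one (hB : B.Nonempty) {M : Multiset (ℕ × ℤ)}
    (hsum : ∀ ξ : ℝ, (M.map fun w => ‖maskProd N B w.1 (p * (ξ + w.2))‖ ^ 2).sum = 1) :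
    (M.map Prod.snd).Nodup := by
  rw [Multiset.nodup_iff_count_le_one]
  intro a
  rw [Multiset.count_map]
  have h := hsum (-a)
  rw [← Multiset.filter_add_not (fun w : ℕ × ℤ => a = w.2) M, Multiset.map_add,
    Multiset.sum_add] at h
  have h1 : ((M.filter fun w => a = w.2).map fun w =>
      ‖maskProd N B w.1 (p * (-(a : ℝ) + w.2))‖ ^ 2) = (M.filter fun w => a = w.2).map fun _ => 1 := by
    refine Multiset.map_congr rfl fun w hw => ?_
    rw [← (Multiset.mem_filter.mp hw).2]
    simp [maskProd_zero_right hB]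
  have h2 : 0 ≤ ((M.filter fun w => ¬ a = w.2).map fun w =>
      ‖maskProd N B w.1 (p * (-(a : ℝ) + w.2))‖ ^ 2).sum := by
    refine Multiset.sum_nonneg fun x hx => ?_
    obtain ⟨w, _, rfl⟩ := Multiset.mem_map.mp hx
    positivity
  rw [h1, Multiset.map_const', Multiset.sum_replicate, nsmul_eq_mul, mul_one] at h
  have : ((M.filter fun w => a = w.2).card : ℝ) ≤ 1 := by linarith
  exact_mod_cast this

/-- A multiset of pairs with distinct second components is the graph of a function. -/
lemma exists_level (M : Multiset (ℕ × ℤ)) (hM : (M.map Prod.snd).Nodup) :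
    ∃ lev : ℤ → ℕ, (∀ a ∈ M.map Prod.snd, (lev a, a) ∈ M) ∧ ∀ q : ℕ → ℤ → ℝ,
      (M.map fun w => q w.1 w.2).sum = ∑ a ∈ (M.map Prod.snd).toFinset, q (lev a) a := by
  classical
  have hex : ∀ a ∈ M.map Prod.snd, ∃ n, (n, a) ∈ M := by
    intro a ha
    obtain ⟨⟨n, b⟩, hw, rfl⟩ := Multiset.mem_map.mp ha
    exact ⟨n, hw⟩
  choose! lev hlev using hex
  refine ⟨lev, hlev, fun q => ?_⟩
  have hinj := Multiset.inj_on_of_nodup_map hM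
  change _ = ((M.map Prod.snd).toFinset.val.map _).sum
  rw [Multiset.toFinset_val, hM.dedup, Multiset.map_map]
  congr 1
  refine Multiset.map_congr rfl fun w hw => ?_
  have := hinj _ (hlev w.2 (Multiset.mem_map_of_mem _ hw)) _ hw rfl
  rw [Function.comp_apply]
  conv_lhs => rw [← this]

/-- The integers that occur in a growing family of residue classes `(n, a)`, each family carrying
the Parseval identity of the corresponding discrete approximations, satisfy the Parseval identity
of `μ_{N,B}`. -/
lemma hasSum_norm_fourierSelfSimilar_sq (hN : 2 ≤ N) (hB : B.Nonempty)
    {M : ℕ → Multiset (ℕ × ℤ)}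
    (hsum : ∀ g, ∀ ξ : ℝ,
      ((M g).map fun w => ‖maskProd N B w.1 (p * (ξ + w.2))‖ ^ 2).sum = 1)
    (hlevel : ∀ g, ∀ w ∈ M g, g ≤ w.1)
    (hmono : ∀ g n a, (n, a) ∈ M g → (n + 1, a) ∈ M (g + 1)) {C ε : ℝ} (hε : 0 < ε)
    (hC : ∀ g, ∀ w ∈ M g, |w.2 / (N : ℝ) ^ w.1| ≤ C)
    (hbd : ∀ g, ∀ w ∈ M g, ε ≤ ‖fourierSelfSimilar N B (p * (w.2 / (N : ℝ) ^ w.1))‖) (ξ : ℝ) :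
    HasSum (fun a : {a : ℤ | ∃ g, a ∈ (M g).map Prod.snd} =>
      ‖fourierSelfSimilar N B (p * (ξ + (a : ℤ)))‖ ^ 2) 1 := by
  classical
  have hN2 : (1 : ℝ) < N := by exact_mod_cast hN
  choose lev hlev hq using fun g => exists_level (M g) (nodup_map_snd_of_sum_eq_one hB (hsum g))
  let A : ℕ → Finset ℤ := fun g => ((M g).map Prod.snd).toFinset
  have hAmem : ∀ g a, a ∈ A g ↔ a ∈ (M g).map Prod.snd := fun g a => Multiset.mem_toFinset
  have hmonoA : Monotone A := by
    refine monotone_nat_of_le_succ fun g a ha => ?_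
    rw [hAmem] at ha ⊢
    obtain ⟨⟨n, b⟩, hw, rfl⟩ := Multiset.mem_map.mp ha
    exact Multiset.mem_map.mpr ⟨(n + 1, b), hmono g n b hw, rfl⟩
  let Λ : Set ℤ := {a : ℤ | ∃ g, a ∈ (M g).map Prod.snd}
  have hΛ : ∀ a, a ∈ Λ ↔ ∃ g, a ∈ A g := fun a => exists_congr fun g => (hAmem g a).symm
  let f : ℤ → ℝ := fun a => ‖fourierSelfSimilar N B (p * (ξ + a))‖ ^ 2
  let F : ℕ → ℤ → ℝ := fun g a =>
    if a ∈ A g then ‖maskProd N B (lev g a) (p * (ξ + a))‖ ^ 2 else 0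
  have hF1 : ∀ g, ∑ a ∈ A g, ‖maskProd N B (lev g a) (p * (ξ + a))‖ ^ 2 = 1 := fun g => by
    rw [← hsum g ξ]
    exact (hq g fun n a => ‖maskProd N B n (p * (ξ + a))‖ ^ 2).symm
  have hFsum : ∀ g, ∑' a, F g a = 1 := fun g => by
    rw [tsum_eq_sum (s := A g) fun a ha => if_neg ha, ← hF1 g]
    exact Finset.sum_congr rfl fun a ha => if_pos ha
  have hsummable : Summable (Λ.indicator f) := by
    refine summable_of_sum_le (c := 1)
      (fun a => Set.indicator_nonneg (fun _ _ => by positivity) a) fun u => ?_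
    -- The sets A g increase, so a finite part of Λ lies in a single one.
    obtain ⟨g, hg⟩ : ∃ g, ∀ a ∈ u, a ∈ Λ → a ∈ A g := by
      have : ∀ a : ℤ, ∃ g, a ∈ Λ → a ∈ A g := fun a => by
        by_cases ha : a ∈ Λ
        · obtain ⟨g, hg⟩ := (hΛ a).mp ha
          exact ⟨g, fun _ => hg⟩
        · exact ⟨0, fun h => absurd h ha⟩
      choose G hG using this
      exact ⟨u.sup G, fun a ha h => hmonoA (Finset.le_sup ha) (hG a h)⟩
    calc ∑ a ∈ u, Λ.indicator f a = ∑ a ∈ u with a ∈ Λ, f a := by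
          rw [Finset.sum_filter]
          exact Finset.sum_congr rfl fun a _ => Set.indicator_apply _ _ _
      _ ≤ ∑ a ∈ A g, f a := by
          refine Finset.sum_le_sum_of_subset_of_nonneg (fun a ha => ?_) fun _ _ _ => by positivity
          obtain ⟨h1, h2⟩ := Finset.mem_filter.mp ha
          exact hg a h1 h2
      _ ≤ ∑ a ∈ A g, ‖maskProd N B (lev g a) (p * (ξ + a))‖ ^ 2 := by
          refine Finset.sum_le_sum fun a _ => ?_
          exact pow_le_pow_left₀ (norm_nonneg _)
            (norm_fourierSelfSimilar_le_norm_maskProd hN hB (lev g a) (p * (ξ + a))) 2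
      _ = 1 := hF1 g
  have hlim : ∀ a, Filter.Tendsto (fun g => F g a) Filter.atTop (nhds (Λ.indicator f a)) := by
    intro a
    by_cases ha : a ∈ Λ
    · obtain ⟨g₀, hg₀⟩ := (hΛ a).mp ha
      have hev : ∀ᶠ g in Filter.atTop, a ∈ A g := by
        filter_upwards [Filter.eventually_ge_atTop g₀] with g hg using hmonoA hg hg₀
      have hl : Filter.Tendsto (fun g => lev g a) Filter.atTop Filter.atTop := by
        refine Filter.tendsto_atTop_mono' _ ?_ Filter.tendsto_id
        filter_upwards [hev] with g hg
        exact hlevel g _ (hlev g a ((hAmem g a).mp hg))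
      rw [Set.indicator_of_mem ha]
      refine Filter.Tendsto.congr' ?_ ((tendsto_maskProd hN hB hl (p * (ξ + a))).norm.pow 2)
      filter_upwards [hev] with g hg using (if_pos hg).symm
    · rw [Set.indicator_of_notMem ha]
      refine tendsto_const_nhds.congr fun g => (if_neg fun h => ha ((hΛ a).mpr ⟨g, h⟩)).symm
  -- The tail argument p(ξ + a) / N^n differs from p a / N^n by pξ / N^n. For g large, uniform
  -- continuity keeps the tail at least ε / 2 in modulus, so the finite product is at most 2 / ε
  -- times the transform.
  have hbound : ∀ᶠ g in Filter.atTop, ∀ a, ‖F g a‖ ≤ (2 / ε) ^ 2 * Λ.indicator f a := by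
    have huc := (isCompact_closedBall (0 : ℝ) (p * C + 1)).uniformContinuousOn_of_continuous
      (continuous_fourierSelfSimilar (N := N) (B := B)).continuousOn
    obtain ⟨δ, hδ, hδε⟩ := Metric.uniformContinuousOn_iff.mp huc (ε / 2) (half_pos hε)
    have hsmall := (tendsto_div_pow_atTop hN Filter.tendsto_id |p * ξ|).eventually
      (gt_mem_nhds (lt_min hδ one_pos))
    filter_upwards [hsmall] with g hg a
    by_cases ha : a ∈ A g
    · have hw := hlev g a ((hAmem g a).mp ha)
      set n := lev g a with hn
      have hgn : g ≤ n := hlevel g _ hw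
      have hxC := hC g _ hw
      have hxε := hbd g _ hw
      simp only at hxC hxε
      set x : ℝ := a / (N : ℝ) ^ n with hx
      have hNn : (0 : ℝ) < (N : ℝ) ^ n := by positivity
      set z : ℝ := p * ξ / (N : ℝ) ^ n with hz
      have hzlt : |z| < min δ 1 := by
        refine lt_of_le_of_lt ?_ hg
        rw [hz, abs_div, abs_of_pos hNn]
        exact div_le_div_of_nonneg_left (abs_nonneg _) (by simp; positivity)
          (pow_le_pow_right₀ hN2.le hgn)
      have hpx : |p * x| ≤ p * C := by
        rw [abs_mul, Nat.abs_cast]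
        gcongr
      have hd := hδε (p * x + z) (by
          rw [mem_closedBall_zero_iff, Real.norm_eq_abs]
          exact (abs_add_le _ _).trans (add_le_add hpx (hzlt.le.trans (min_le_right _ _))))
        (p * x) (by
          rw [mem_closedBall_zero_iff, Real.norm_eq_abs]
          linarith) (by
          rw [Real.dist_eq, add_sub_cancel_left]
          exact hzlt.trans_le (min_le_left _ _))
      have hlow : ε / 2 ≤ ‖fourierSelfSimilar N B (p * (ξ + a) / (N : ℝ) ^ n)‖ := by
        have e : (p * (ξ + a) / (N : ℝ) ^ n : ℝ) = p * x + z := by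
          rw [hx, hz]
          ring
        rw [e]
        rw [dist_comm, dist_eq_norm] at hd
        have := norm_sub_norm_le (fourierSelfSimilar N B (p * x))
          (fourierSelfSimilar N B (p * x + z))
        linarith
      have hval : F g a = ‖maskProd N B n (p * (ξ + a))‖ ^ 2 := if_pos ha
      rw [Set.indicator_of_mem ((hΛ a).mpr ⟨g, ha⟩), hval, Real.norm_of_nonneg (by positivity)]
      change _ ≤ _ * ‖fourierSelfSimilar N B (p * (ξ + a))‖ ^ 2
      rw [← mul_pow]
      gcongr
      rw [fourierSelfSimilar_eq_maskProd_mul hN hB n, norm_mul, div_mul_eq_mul_div,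
        le_div_iff₀ hε]
      nlinarith [norm_nonneg (maskProd N B n (p * (ξ + a)))]
    · have hval : F g a = 0 := if_neg ha
      rw [hval, norm_zero]
      exact mul_nonneg (by positivity) (Set.indicator_nonneg (fun _ _ => by positivity) a)
  have ht := tendsto_tsum_of_dominated_convergence (hsummable.mul_left _) hlim hbound
  simp only [hFsum] at ht
  have h1 : ∑' a, Λ.indicator f a = 1 := tendsto_nhds_unique ht tendsto_const_nhds
  have := hsummable.hasSum
  rw [h1] at this
  exact hasSum_subtype_iff_indicator.mpr this

end Limit

/-! ### From the Parseval identity to spectra -/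

section Parseval

variable {μ : Measure ℝ}

lemma inner_exponential [IsFiniteMeasure μ] (r s : ℝ) :
    inner ℂ (exponential μ r) (exponential μ s) = charFun μ (2 * Real.pi * (s - r)) := by
  rw [MeasureTheory.L2.inner_def, charFun_apply_real]
  refine integral_congr_ae ?_
  filter_upwards [(memLp_exponential μ r).coeFn_toLp, (memLp_exponential μ s).coeFn_toLp]
    with x hr hs
  unfold exponential
  rw [hr, hs, RCLike.inner_apply, ← Complex.exp_conj, ← Complex.exp_add]
  congr 1
  simp only [map_mul, Complex.conj_ofReal, Complex.conj_I, map_ofNat]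
  push_cast
  ring

lemma norm_exponential [IsProbabilityMeasure μ] (r : ℝ) : ‖exponential μ r‖ = 1 := by
  have h : ‖exponential μ r‖ ^ 2 = 1 := by
    rw [@norm_sq_eq_re_inner ℂ, inner_exponential]
    simp
  exact (pow_eq_one_iff_of_nonneg (norm_nonneg _) two_ne_zero).mp h

/-- A real integrable function whose Fourier transform with respect to `μ` vanishes is zero. -/
lemma ae_eq_zero_of_integral_cexp_mul_eq_zero [IsFiniteMeasure μ] {u : ℝ → ℝ}
    (hu : Integrable u μ)
    (h : ∀ t : ℝ, ∫ x, Complex.exp (t * x * Complex.I) * (u x : ℂ) ∂μ = 0) : u =ᵐ[μ] 0 := by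
  have hdens : ∀ v : ℝ → ℝ, Integrable v μ → (∀ x, 0 ≤ v x) → ∀ t : ℝ,
      charFun (μ.withDensity fun x => ENNReal.ofReal (v x)) t =
        ∫ x, Complex.exp (t * x * Complex.I) * (v x : ℂ) ∂μ := by
    intro v hv hv0 t
    rw [charFun_apply_real, integral_withDensity_eq_integral_toReal_smul₀
      hv.aemeasurable.ennreal_ofReal (by simp)]
    refine integral_congr_ae (Filter.Eventually.of_forall fun x => ?_)
    simp only [ENNReal.toReal_ofReal (hv0 x), Complex.real_smul]
    ring
  have hp : Integrable (fun x => max (u x) 0) μ := hu.pos_part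
  have hn : Integrable (fun x => max (-u x) 0) μ := hu.neg_part
  have hint : ∀ v : ℝ → ℝ, Integrable v μ → ∀ t : ℝ,
      Integrable (fun x : ℝ => Complex.exp (t * x * Complex.I) * (v x : ℂ)) μ := by
    intro v hv t
    refine hv.ofReal.bdd_mul (c := 1) (by fun_prop) (Filter.Eventually.of_forall fun x => ?_)
    rw [← Complex.ofReal_mul, Complex.norm_exp_ofReal_mul_I]
  have : IsFiniteMeasure (μ.withDensity fun x => ENNReal.ofReal (max (u x) 0)) :=
    isFiniteMeasure_withDensity_ofReal hp.2
  have : IsFiniteMeasure (μ.withDensity fun x => ENNReal.ofReal (max (-u x) 0)) :=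
    isFiniteMeasure_withDensity_ofReal hn.2
  -- The positive and negative parts of u define finite measures with equal characteristic
  -- functions.
  have heq : (μ.withDensity fun x => ENNReal.ofReal (max (u x) 0)) =
      μ.withDensity fun x => ENNReal.ofReal (max (-u x) 0) := by
    refine Measure.ext_of_charFun (funext fun t => ?_)
    rw [hdens _ hp (fun _ => le_max_right _ _), hdens _ hn (fun _ => le_max_right _ _),
      ← sub_eq_zero, ← integral_sub (hint _ hp t) (hint _ hn t), ← h t]
    refine integral_congr_ae (Filter.Eventually.of_forall fun x => ?_)
    simp only
    rw [← mul_sub, ← Complex.ofReal_sub]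
    congr 2
    rcases le_total (u x) 0 with h0 | h0
    · rw [max_eq_right h0, max_eq_left (by linarith)]; ring
    · rw [max_eq_left h0, max_eq_right (by linarith)]; ring
  have hae := (withDensity_eq_iff hp.aemeasurable.ennreal_ofReal hn.aemeasurable.ennreal_ofReal
    hp.lintegral_lt_top.ne).mp heq
  filter_upwards [hae] with x hx
  rw [ENNReal.ofReal_eq_ofReal_iff (le_max_right _ _) (le_max_right _ _)] at hx
  rcases le_total (u x) 0 with h0 | h0
  · rw [max_eq_right h0, max_eq_left (by linarith)] at hx
    simp only [Pi.zero_apply]; linarith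
  · rw [max_eq_left h0, max_eq_right (by linarith)] at hx
    simp only [Pi.zero_apply]; linarith

/-- The exponentials are total in `L²(μ)`. -/
lemma eq_zero_of_inner_exponential_eq_zero [IsFiniteMeasure μ] (f : Lp ℂ 2 μ)
    (h : ∀ r : ℝ, inner ℂ (exponential μ r) f = 0) : f = 0 := by
  have hf : Integrable f μ := (Lp.memLp f).integrable (by norm_num)
  have h1 : ∀ t : ℝ, ∫ x, Complex.exp (t * x * Complex.I) * f x ∂μ = 0 := by
    intro t
    rw [← h (-t / (2 * Real.pi)), MeasureTheory.L2.inner_def]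
    refine integral_congr_ae ?_
    filter_upwards [(memLp_exponential μ (-t / (2 * Real.pi))).coeFn_toLp] with x hx
    unfold exponential
    rw [hx, RCLike.inner_apply, ← Complex.exp_conj, mul_comm]
    congr 2
    simp only [map_mul, Complex.conj_ofReal, Complex.conj_I, map_ofNat]
    have : (Real.pi : ℂ) ≠ 0 := by exact_mod_cast Real.pi_ne_zero
    push_cast
    field_simp
  have h2 : ∀ t : ℝ, ∫ x, Complex.exp (t * x * Complex.I) * (starRingEnd ℂ) (f x) ∂μ = 0 := by
    intro t
    have := congrArg (starRingEnd ℂ) (h1 (-t))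
    rw [← integral_conj, map_zero] at this
    rw [← this]
    refine integral_congr_ae (Filter.Eventually.of_forall fun x => ?_)
    simp only
    rw [map_mul, ← Complex.exp_conj]
    congr 2
    simp only [map_mul, Complex.conj_ofReal, Complex.conj_I]
    push_cast
    ring
  have hint : ∀ v : ℝ → ℂ, Integrable v μ → ∀ t : ℝ,
      Integrable (fun x : ℝ => Complex.exp (t * x * Complex.I) * v x) μ := by
    intro v hv t
    refine hv.bdd_mul (c := 1) (by fun_prop) (Filter.Eventually.of_forall fun x => ?_)
    rw [← Complex.ofReal_mul, Complex.norm_exp_ofReal_mul_I]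
  have hfc : Integrable (fun x => (starRingEnd ℂ) (f x)) μ :=
    (LinearIsometryEquiv.integrable_comp_iff (Complex.conjLIE)).mpr hf
  have hre : (fun x => (f x).re) =ᵐ[μ] 0 := by
    refine ae_eq_zero_of_integral_cexp_mul_eq_zero hf.re fun t => ?_
    have e : ∀ x : ℝ, Complex.exp (t * x * Complex.I) * ((f x).re : ℂ) =
        (1 / 2) * (Complex.exp (t * x * Complex.I) * f x +
          Complex.exp (t * x * Complex.I) * (starRingEnd ℂ) (f x)) := by
      intro x
      rw [Complex.re_eq_add_conj]
      ring
    simp only [e]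
    rw [integral_const_mul, integral_add (hint _ hf t) (hint _ hfc t), h1, h2, add_zero, mul_zero]
  have him : (fun x => (f x).im) =ᵐ[μ] 0 := by
    refine ae_eq_zero_of_integral_cexp_mul_eq_zero hf.im fun t => ?_
    have e : ∀ x : ℝ, Complex.exp (t * x * Complex.I) * ((f x).im : ℂ) =
        (1 / (2 * Complex.I)) * (Complex.exp (t * x * Complex.I) * f x -
          Complex.exp (t * x * Complex.I) * (starRingEnd ℂ) (f x)) := by
      intro x
      rw [Complex.im_eq_sub_conj]
      ring
    simp only [e]
    rw [integral_const_mul, integral_sub (hint _ hf t) (hint _ hfc t), h1, h2, sub_zero, mul_zero]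
  refine (Lp.eq_zero_iff_ae_eq_zero).mpr ?_
  filter_upwards [hre, him] with x hx hy
  exact Complex.ext hx hy

/-- The Jorgensen–Pedersen criterion: a set satisfying the Parseval identity for all exponentials is
a spectrum. -/
lemma isSpectrum_of_hasSum [IsProbabilityMeasure μ] {Λ : Set ℝ}
    (h : ∀ ξ : ℝ, HasSum (fun r : Λ => ‖charFun μ (2 * Real.pi * (ξ + r))‖ ^ 2) 1) :
    IsSpectrum μ Λ := by
  classical
  have horth : Orthonormal ℂ (fun r : Λ => exponential μ (r : ℝ)) := by
    refine ⟨fun r => norm_exponential _, fun r s hrs => ?_⟩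
    change inner ℂ (exponential μ (r : ℝ)) (exponential μ (s : ℝ)) = 0
    rw [inner_exponential]
    -- At ξ = -r the term of r is already 1, which forces the term of s to vanish.
    have hle := sum_le_hasSum {r, s} (fun _ _ => by positivity) (h (-(r : ℝ)))
    rw [Finset.sum_pair hrs] at hle
    simp only [neg_add_cancel, mul_zero, charFun_zero, probReal_univ] at hle
    have h0 : ‖charFun μ (2 * Real.pi * (-(r : ℝ) + s))‖ ^ 2 ≤ 0 := by
      simp only [Complex.ofReal_one, norm_one, one_pow] at hle
      linarith
    have h1 := pow_eq_zero_iff (two_ne_zero) |>.mp (le_antisymm h0 (by positivity))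
    rw [norm_eq_zero, neg_add_eq_sub] at h1
    exact h1
  refine ⟨horth, ?_⟩
  rw [Submodule.topologicalClosure_eq_top_iff, Submodule.eq_bot_iff]
  intro f hf
  set V := (Submodule.span ℂ (Set.range fun r : Λ => exponential μ (r : ℝ))).topologicalClosure
    with hV
  have : CompleteSpace V := Submodule.topologicalClosure.completeSpace _
  have hfV : f ∈ Vᗮ := by rwa [hV, Submodule.orthogonal_closure]
  have hmem : ∀ ξ : ℝ, exponential μ ξ ∈ V := by
    intro ξ
    set e := exponential μ ξ
    have hin : ∀ r : Λ, inner ℂ (exponential μ (r : ℝ)) (V.starProjection e) =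
        charFun μ (2 * Real.pi * (ξ - r)) := by
      intro r
      have hr : exponential μ (r : ℝ) ∈ V :=
        Submodule.le_topologicalClosure _ (Submodule.subset_span ⟨r, rfl⟩)
      rw [← inner_exponential, ← V.inner_starProjection_left_eq_right,
        Submodule.starProjection_eq_self_iff.mpr hr]
    -- Bessel's inequality for the projection of e: its coefficients are those of e, with squares
    -- summing to 1 = ‖e‖², so projecting loses no norm and e lies in V.
    have hB := horth.tsum_inner_products_le (V.starProjection e)
    have hs := (h (-ξ)).tsum_eq
    have hsum : ∑' r : Λ, ‖inner ℂ (exponential μ (r : ℝ)) (V.starProjection e)‖ ^ 2 = 1 := by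
      rw [← hs]
      refine tsum_congr fun r => ?_
      rw [hin, ← RCLike.norm_conj, ← charFun_neg]
      congr 3
      ring
    rw [hsum] at hB
    have he : ‖e‖ = 1 := norm_exponential ξ
    rw [V.mem_iff_norm_starProjection]
    refine le_antisymm (V.norm_starProjection_apply_le e) ?_
    rw [he]
    exact (one_le_sq_iff₀ (norm_nonneg _)).mp hB
  refine eq_zero_of_inner_exponential_eq_zero f fun ξ => ?_
  exact (Submodule.mem_orthogonal _ _).mp hfV _ (hmem ξ)

end Parseval

/-! ### Density of the eigenvalue set -/

section Eigenvalues

lemma div_mem_eigenvalueSet {N a b : ℕ} (ha : 0 < a) (hb : 0 < b) (haN : a.Coprime N)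
    (hbN : b.Coprime N) : (a / b : ℝ) ∈ eigenvalueSet N := by
  obtain ⟨g, a', b', hg, hab, rfl, rfl⟩ := Nat.exists_coprime' (Nat.gcd_pos_of_pos_left b ha)
  refine ⟨b', a', Nat.pos_of_mul_pos_right hb, Nat.pos_of_mul_pos_right ha, hab.symm,
    Nat.Coprime.mul_left (Nat.Coprime.coprime_mul_right hbN)
      (Nat.Coprime.coprime_mul_right haN), ?_⟩
  have : (g : ℝ) ≠ 0 := by exact_mod_cast hg.ne'
  push_cast
  rw [mul_div_mul_right _ _ this]

/-- A point x ≥ 0 is the limit of (N⌊xs⌋ + 1) / (Ns + 1), whose numerator and denominator are 1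
modulo N. -/
lemma closure_eigenvalueSet {N : ℕ} (hN : N ≠ 0) : closure (eigenvalueSet N) = Set.Ici (0 : ℝ) := by
  refine Set.Subset.antisymm (closure_minimal ?_ isClosed_Ici) fun x hx => ?_
  · rintro t ⟨u, v, _, _, _, _, rfl⟩
    exact Set.mem_Ici.mpr (by positivity)
  · have hN0 : (0 : ℝ) < N := by exact_mod_cast Nat.pos_of_ne_zero hN
    have h1 : Filter.Tendsto (fun s : ℕ => (⌊x * s⌋₊ / s : ℝ)) Filter.atTop (nhds x) :=
      (tendsto_nat_floor_mul_div_atTop hx).comp tendsto_natCast_atTop_atTop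
    have h2 : Filter.Tendsto (fun s : ℕ => (1 / (N * s) : ℝ)) Filter.atTop (nhds 0) :=
      (tendsto_natCast_atTop_atTop.const_mul_atTop hN0).const_div_atTop 1
    have h3 := (h1.add h2).div (tendsto_const_nhds (x := (1 : ℝ)).add h2) (by simp)
    rw [add_zero, add_zero, div_one] at h3
    have hcop : ∀ m : ℕ, (N * m + 1).Coprime N := fun m => by simp
    refine mem_closure_of_tendsto
      (f := fun s : ℕ => (((N * ⌊x * s⌋₊ + 1 : ℕ) : ℝ) / ((N * s + 1 : ℕ) : ℝ)))
      (h3.congr' ?_) (Filter.Eventually.of_forall fun s =>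
        div_mem_eigenvalueSet (Nat.succ_pos _) (Nat.succ_pos _) (hcop _) (hcop _))
    filter_upwards [Filter.eventually_gt_atTop 0] with s hs
    have hs' : (0 : ℝ) < s := by exact_mod_cast hs
    simp only [Pi.div_apply]
    push_cast
    field_simp

end Eigenvalues

/-! ### Construction of common spectra -/

section Spectra

variable {N : ℕ} {B L : Finset ℤ}

/-- A set of integers, all of whose dilations by the elements of a given finite set of integers
coprime to `N` are spectra of `μ_{N,B}`. -/
theorem IsHadamardTriple.exists_common_spectrum (hT : IsHadamardTriple N B L) (hB : B.card < N)
    (P : Finset ℕ) (hP : ∀ p ∈ P, p.Coprime N) :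
    ∃ Λ : Set ℤ, 0 ∈ Λ ∧ (∃ a ∈ Λ, a ≠ 0) ∧
      ∀ p ∈ P, IsSpectrum (selfSimilarMeasure N B : Measure ℝ) ((fun a : ℤ => (p * a : ℝ)) '' Λ) := by
  classical
  have hN := hT.two_le
  have hBne := hT.nonempty_left
  -- Including 1 gives the Parseval identity for Λ itself, used to exclude Λ = {0}.
  have hpos : ∀ p ∈ insert 1 P, 0 < p := by
    intro p hp
    rcases Finset.mem_insert.mp hp with rfl | hp
    · exact one_pos
    · refine Nat.pos_of_ne_zero fun h => ?_
      have := hP p hp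
      rw [h, Nat.coprime_zero_left] at this
      omega
  have hcop : ∀ p ∈ insert 1 P, p.Coprime N := by
    intro p hp
    rcases Finset.mem_insert.mp hp with rfl | hp
    · exact Nat.coprime_one_left N
    · exact hP p hp
  obtain ⟨l₀, hl₀, l₁, hl₁, hne⟩ := Finset.one_lt_card.mp
    (show 1 < L.card by have := hT.two_le_card; have := hT.card_eq; omega)
  -- The tree needs 0 as a digit; translating L is harmless because the identity holds for all y.
  let L' := L.image fun l => l - l₀
  have hL'0 : (0 : ℤ) ∈ L' := Finset.mem_image.mpr ⟨l₀, hl₀, sub_self _⟩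
  have hL'N : L'.card < N := Finset.card_image_le.trans_lt (hT.card_eq ▸ hB)
  have hL' : ∀ p ∈ insert 1 P, ∀ y : ℝ, ∑ l ∈ L', ‖mask B (p * (y + l) / N)‖ ^ 2 = 1 := by
    intro p hp y
    rw [Finset.sum_image (fun _ _ _ _ h => sub_left_injective h),
      ← hT.sum_norm_mask_sq (hcop p hp) (y - l₀)]
    refine Finset.sum_congr rfl fun l _ => ?_
    push_cast
    ring_nf
  obtain ⟨k, c, C, ε, hε, hbd⟩ := exists_tree_bound (B := B) hN hBne hL'N hpos
  have hsum := fun p (hp : p ∈ insert 1 P) => hasSum_norm_fourierSelfSimilar_sq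
    (M := treeNodes N L' k c) (p := p) hN hBne
    (fun g ξ => sum_treeNodes (by omega) (hL' p hp) hL'0 k c g ξ)
    (fun g w hw => le_fst_of_mem_treeNodes hw) (fun g n a h => mem_treeNodes_succ h) hε
    (fun g w hw => (hbd g w hw).1) (fun g w hw => (hbd g w hw).2 p hp)
  refine ⟨{a : ℤ | ∃ g, a ∈ (treeNodes N L' k c g).map Prod.snd}, ⟨0, by simp [treeNodes]⟩, ?_,
    fun p hp => isSpectrum_of_hasSum fun ξ => ?_⟩
  · by_contra! h
    -- If Λ = {0}, the identity at ξ = l₁ - l₀ has the single term |μ̂(l₁ - l₀)|², which is 0 by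
    -- orthogonality of the columns l₀ and l₁.
    have hs := hsum 1 (Finset.mem_insert_self _ _) (l₁ - l₀ : ℤ)
    have hz : fourierSelfSimilar N B (l₁ - l₀ : ℤ) = 0 := by
      rw [fourierSelfSimilar_eq_mask_mul hN hBne, mask]
      have := hT.sum_unitExp_eq_zero hl₀ hl₁ hne
      simp only [Int.cast_mul, mul_div_assoc] at this
      rw [this, mul_zero, zero_mul]
    have h0 : (fun a : {a : ℤ | ∃ g, a ∈ (treeNodes N L' k c g).map Prod.snd} =>
        ‖fourierSelfSimilar N B ((1 : ℕ) * ((l₁ - l₀ : ℤ) + (a : ℤ)))‖ ^ 2) = fun _ => 0 := by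
      funext a
      rw [h a a.2, Int.cast_zero, add_zero, Nat.cast_one, one_mul, hz]
      simp
    rw [h0] at hs
    exact zero_ne_one (hasSum_zero.unique hs)
  · have hp' := Finset.mem_insert_of_mem (b := 1) hp
    have hp0 : (p : ℝ) ≠ 0 := by exact_mod_cast (hpos p hp').ne'
    have hinj : Function.Injective fun a : ℤ => (p * a : ℝ) := fun a b h => by
      exact_mod_cast mul_left_cancel₀ hp0 h
    -- Since ξ + p a = p (ξ / p + a), the identity for pΛ at ξ is the one for Λ at ξ / p.
    rw [← (Equiv.Set.image _ _ hinj).hasSum_iff]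
    convert hsum p hp' (ξ / p) using 1
    funext a
    simp only [Function.comp_apply, Equiv.Set.image_apply, fourierSelfSimilar]
    congr 4
    field_simp

/-- The least nonzero absolute value in the dilated set grows strictly with the factor. -/
lemma injective_image_mul {Λ : Set ℤ} (hΛ : ∃ a ∈ Λ, a ≠ 0) {s : ℕ → ℕ} (hs : StrictMono s)
    (hs0 : ∀ n, 0 < s n) :
    Function.Injective fun n => (fun a : ℤ => (s n * a : ℝ)) '' Λ := by
  classical
  have hex : ∃ m : ℕ, ∃ a ∈ Λ, a ≠ 0 ∧ a.natAbs = m := by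
    obtain ⟨a, ha, h0⟩ := hΛ
    exact ⟨_, a, ha, h0, rfl⟩
  obtain ⟨a, ha, h0, hm⟩ := Nat.find_spec hex
  refine Function.Injective.of_lt_imp_ne fun i j hij heq => ?_
  have hlt := hs hij
  have hmem : (s i * a : ℝ) ∈ (fun a : ℤ => (s j * a : ℝ)) '' Λ := by
    rw [← heq]
    exact ⟨a, ha, rfl⟩
  obtain ⟨b, hb, hab⟩ := hmem
  simp only at hab
  have hab' : (s j : ℤ) * b = s i * a := by exact_mod_cast hab
  have habs : s j * b.natAbs = s i * a.natAbs := by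
    simpa [Int.natAbs_mul] using congrArg Int.natAbs hab'
  have ha0 : 0 < a.natAbs := Int.natAbs_pos.mpr h0
  have hb0 : b ≠ 0 := by
    rintro rfl
    simp only [Int.natAbs_zero, mul_zero] at habs
    exact (Nat.mul_pos (hs0 i) ha0).ne habs
  have hle : a.natAbs ≤ b.natAbs := hm ▸ Nat.find_min' hex ⟨b, hb, hb0, rfl⟩
  have hlt' : s i * a.natAbs < s j * b.natAbs :=
    (Nat.mul_lt_mul_of_pos_right hlt ha0).trans_le (Nat.mul_le_mul_left _ hle)
  omega

/-- For finitely many elements of `eigenvalueSet N`, there are infinitely many common spectra. -/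
theorem IsHadamardTriple.infinite_common_spectra (hT : IsHadamardTriple N B L) (hB : B.card < N)
    (k : ℕ) (t : Fin k → ℝ) (ht : ∀ i, t i ∈ eigenvalueSet N) :
    {Λ : Set ℝ | (0 : ℝ) ∈ Λ ∧ IsSpectrum (selfSimilarMeasure N B : Measure ℝ) Λ ∧
      ∀ i, IsSpectrum (selfSimilarMeasure N B : Measure ℝ) (t i • Λ)}.Infinite := by
  classical
  choose u v hu hv _ huv ht using ht
  have huN : ∀ i, (u i).Coprime N := fun i => Nat.Coprime.coprime_mul_right (huv i)
  have hvN : ∀ i, (v i).Coprime N := fun i => Nat.Coprime.coprime_mul_left (huv i)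
  let U := ∏ i, u i
  have hU0 : 0 < U := Finset.prod_pos fun i _ => hu i
  have hUN : U.Coprime N := Nat.Coprime.prod_left fun i _ => huN i
  have hdvd : ∀ i, u i ∣ U := fun i => Finset.dvd_prod_of_mem u (Finset.mem_univ i)
  have htU : ∀ i, t i * U = (v i * (U / u i) : ℕ) := fun i => by
    have : (u i : ℝ) ≠ 0 := by exact_mod_cast (hu i).ne'
    rw [ht i, Nat.cast_mul, Nat.cast_div (hdvd i) this]
    ring
  have hqN : ∀ n, ((N + 1) ^ n).Coprime N := fun n => Nat.Coprime.pow_left n (by simp)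
  -- Λ depends on a finite set of factors, so r must be fixed before Λ is built.
  suffices H : ∀ r : ℕ, ∃ s : Finset (Set ℝ), s.card = r ∧ ∀ Λ ∈ s, (0 : ℝ) ∈ Λ ∧
      IsSpectrum (selfSimilarMeasure N B : Measure ℝ) Λ ∧
      ∀ i, IsSpectrum (selfSimilarMeasure N B : Measure ℝ) (t i • Λ) by
    intro hfin
    obtain ⟨s, hs, hsub⟩ := H (hfin.toFinset.card + 1)
    have : s ⊆ hfin.toFinset := fun Λ hΛ => hfin.mem_toFinset.mpr (hsub Λ hΛ)
    have := Finset.card_le_card this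
    omega
  intro r
  -- U gives the base spectrum UΛ; the other factors give its dilations t_i UΛ.
  let Q : Finset ℕ := insert U (Finset.univ.image fun i => v i * (U / u i))
  have hQN : ∀ q ∈ Q, q.Coprime N := by
    intro q hq
    rcases Finset.mem_insert.mp hq with rfl | hq
    · exact hUN
    · obtain ⟨i, _, rfl⟩ := Finset.mem_image.mp hq
      exact Nat.Coprime.mul_left (hvN i)
        (Nat.Coprime.of_dvd_left (Nat.div_dvd_of_dvd (hdvd i)) hUN)
  obtain ⟨Λ, h0, hne, hspec⟩ := hT.exists_common_spectrum hB
    ((Finset.range r ×ˢ Q).image fun x => (N + 1) ^ x.1 * x.2) (by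
      intro p hp
      obtain ⟨x, hx, rfl⟩ := Finset.mem_image.mp hp
      exact Nat.Coprime.mul_left (hqN _) (hQN _ (Finset.mem_product.mp hx).2))
  have hspec' : ∀ n < r, ∀ q ∈ Q, IsSpectrum (selfSimilarMeasure N B : Measure ℝ)
      ((fun a : ℤ => (((N + 1) ^ n * q : ℕ) * a : ℝ)) '' Λ) := fun n hn q hq =>
    hspec _ (Finset.mem_image.mpr
      ⟨(n, q), Finset.mk_mem_product (Finset.mem_range.mpr hn) hq, rfl⟩)
  have hmono : StrictMono fun n : ℕ => (N + 1) ^ n * U := fun i j hij =>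
    Nat.mul_lt_mul_of_pos_right
      (Nat.pow_lt_pow_right (by have := hT.two_le; omega) hij) hU0
  refine ⟨(Finset.range r).image fun n => (fun a : ℤ => (((N + 1) ^ n * U : ℕ) * a : ℝ)) '' Λ,
    ?_, fun S hS => ?_⟩
  · rw [Finset.card_image_of_injective _ (injective_image_mul hne hmono
      fun n => Nat.mul_pos (by positivity) hU0), Finset.card_range]
  · obtain ⟨n, hn, rfl⟩ := Finset.mem_image.mp hS
    have hn' := Finset.mem_range.mp hn
    refine ⟨⟨0, h0, by simp⟩, hspec' n hn' U (Finset.mem_insert_self _ _), fun i => ?_⟩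
    have := hspec' n hn' _ (Finset.mem_insert_of_mem
      (Finset.mem_image_of_mem (fun i => v i * (U / u i)) (Finset.mem_univ i)))
    convert this using 1
    rw [← Set.image_smul, Set.image_image]
    refine Set.image_congr fun a _ => ?_
    rw [smul_eq_mul, Nat.cast_mul, Nat.cast_mul, ← htU i]
    ring

end Spectra

theorem corollary1p4 (N : ℕ) (B L : Finset ℤ) (hT : IsHadamardTriple N B L) (hB : B.card < N) :
    (∀ t ∈ eigenvalueSet N, IsSpectralEigenvalue (selfSimilarMeasure N B : Measure ℝ) t) ∧
    closure (eigenvalueSet N) = Set.Ici (0 : ℝ) ∧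
    ∀ (k : ℕ) (t : Fin k → ℝ), (∀ i, t i ∈ eigenvalueSet N) →
      {Λ : Set ℝ | (0 : ℝ) ∈ Λ ∧ IsSpectrum (selfSimilarMeasure N B : Measure ℝ) Λ ∧
        ∀ i, IsSpectrum (selfSimilarMeasure N B : Measure ℝ) (t i • Λ)}.Infinite := by
  refine ⟨fun t ht => ?_, closure_eigenvalueSet (by have := hT.two_le; omega),
    hT.infinite_common_spectra hB⟩
  obtain ⟨Λ, _, h1, h2⟩ := (hT.infinite_common_spectra hB 1 (fun _ => t) fun _ => ht).nonempty
  exact ⟨Λ, h1, h2 0⟩
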